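/- Let $\Sigma$ be a finite alphabet. A language $L\subseteq\Sigma^\omega$ is \emph{monitorable} if for every $u\in\Sigma^*$ there is $v\in\Sigma^*$ such that $uv\Sigma^\omega\subseteq L$ or $uv\Sigma^\omega\cap L=\emptyset$. A deterministic Büchi automaton (DBA) $\mathcal A=(\Sigma,Q,q_0,\delta,F)$ consists of finite sets $\Sigma$ and $Q$, an initial state $q_0\in Q$, a partial transition function $\delta:Q\times\Sigma\rightharpoonup Q$ and a set $F\subseteq Q$; $\mathcal L(\mathcal A)$ is the set of all $w\in\Sigma^\omega$ on which $\mathcal A$ has an infinite run from $q_0$ that visits $F$ infinitely often. $\mathcal A$ is \emph{complete} if $\delta$ is total. Write $\mathcal A(q)$ for $\mathcal A$ with initial state $q$, and $q\leadsto q'$ if there is a (possibly empty) path from $q$ to $q'$. A \emph{trap state} is a state $q\notin F$ with $\delta(q,a)=q$ for all $a\in\Sigma$. \textbf{Theorem.} (1) The problem "given a DBA $\mathcal A$ (not necessarily complete; $|Q|$, $|\Sigma|$, the initial state, the accepting states and the transition table being written out explicitly as a bit string), is $\mathcal L(\mathcal A)$ monitorable?" is decidable by a (multi-stack) Turing machine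 in time polynomial in the length of the input, equivalently in $|Q|+|\Sigma|$. (2) Let $\mathcal A$ be a complete DBA. Then $\mathcal L(\mathcal A)$ is monitorable if and only if for every $q\in Q$ with $q_0\leadsto q$ there is $q'\in Q$ with $q\leadsto q'$ such that $\mathcal L(\mathcal A(q'))=\emptyset$ or $\mathcal L(\mathcal A(q'))=\Sigma^\omega$. If moreover every $q$ with $q_0\leadsto q$ and $\mathcal L(\mathcal A(q))=\emptyset$ is a trap state, then $\mathcal L(\mathcal A)$ is monitorable if and only if for every $q\in Q$ with $q_0\leadsto q$ there is $q'\in Q$ with $q\leadsto q'$ such that $q'$ is a trap state or $\mathcal L(\mathcal A(q'))=\Sigma^\omega$. -/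

import Mathlib

namespace Monitorability

universe u v

/-- `u ∈ good(L)`: the language `L ⊆ S^ω` is positively determined by `u`, i.e. `u S^ω ⊆ L`. -/
def PositivelyDetermined {S : Type u} (L : Set (Stream' S)) (x : List S) : Prop :=
  ∀ w : Stream' S, x ++ₛ w ∈ L

/-- `u ∈ bad(L)`: the language `L ⊆ S^ω` is negatively determined by `u`, i.e. `u S^ω ∩ L = ∅`. -/
def NegativelyDetermined {S : Type u} (L : Set (Stream' S)) (x : List S) : Prop :=
  ∀ w : Stream' S, x ++ₛ w ∉ L

/-- `L ⊆ S^ω` is monitorable: every finite word `x` has a finite extension `x y` that is a good or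
a bad prefix of `L`. -/
def Monitorable {S : Type u} (L : Set (Stream' S)) : Prop :=
  ∀ x : List S, ∃ y : List S, PositivelyDetermined L (x ++ y) ∨ NegativelyDetermined L (x ++ y)

/-- A deterministic Büchi automaton with state set `Q` and alphabet `S`. The transition function
may be partial: `step q a = none` means that `q` has no `a`-successor. -/
structure DBA (Q : Type u) (S : Type v) where
  start : Q
  step : Q → S → Option Q
  accept : Finset Q

namespace DBA

variable {Q : Type u} {S : Type v}

/-- `ρ` is the (infinite) run of `A` on `w`, starting in the initial state. -/
def IsRun (A : DBA Q S) (w : Stream' S) (ρ : ℕ → Q) : Prop :=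
  ρ 0 = A.start ∧ ∀ i : ℕ, A.step (ρ i) (w.get i) = some (ρ (i + 1))

/-- The accepted language: the infinite words with a run that visits accepting states infinitely
often. -/
def language (A : DBA Q S) : Set (Stream' S) :=
  {w | ∃ ρ : ℕ → Q, A.IsRun w ρ ∧ ∃ᶠ i in Filter.atTop, ρ i ∈ A.accept}

/-- The automaton `A(q)`, i.e. `A` with the initial state replaced by `q`. -/
def startingAt (A : DBA Q S) (q : Q) : DBA Q S :=
  { A with start := q }

/-- `q ⇝ q'`: there is a (possibly empty) path from `q` to `q'`. -/
def Reaches (A : DBA Q S) (q q' : Q) : Prop :=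
  Relation.ReflTransGen (fun p p' => ∃ a : S, A.step p a = some p') q q'

/-- Every state has a successor for every symbol. -/
def IsComplete (A : DBA Q S) : Prop :=
  ∀ (q : Q) (a : S), ∃ q' : Q, A.step q a = some q'

/-- A trap state: a non-accepting state with a self-loop for every symbol. -/
def IsTrap (A : DBA Q S) (q : Q) : Prop :=
  q ∉ A.accept ∧ ∀ a : S, A.step q a = some q

end DBA

/-- An instance of the monitorability problem of deterministic Büchi automata: the numbers of
states and of symbols, and an automaton with these (numbered) states and symbols. -/
structure Instance where
  numStates : ℕ
  numSymbols : ℕ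
  aut : DBA (Fin numStates) (Fin numSymbols)

/-- The number `m` as the bit string `1^m 0`. -/
def unary (m : ℕ) : List Bool :=
  List.replicate m true ++ [false]

/-- The table entry for a transition: `0` if there is none, `1^(q+1) 0` if it leads to `q`. -/
def encodeTarget {n : ℕ} : Option (Fin n) → List Bool
  | none => unary 0
  | some q => unary (q.val + 1)

/-- The automaton written out as a bit string: `|Q|`, `|S|` and the initial state, followed, for
each state in turn, by its acceptance bit and its row of the transition table. Since states and
table entries are listed explicitly, the length lies between `|Q| * |S|` and a polynomial in
`|Q|` and `|S|` (writing numbers in unary costs a factor of at most about `|Q|` over binary). -/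
def Instance.encode (I : Instance) : List Bool :=
  unary I.numStates ++ unary I.numSymbols ++ unary I.aut.start.val ++
    (List.finRange I.numStates).flatMap fun q =>
      decide (q ∈ I.aut.accept) ::
        (List.finRange I.numSymbols).flatMap fun a => encodeTarget (I.aut.step q a)

/-- The decision problem `P`, with inputs presented through the encoding `enc`, is solved by a
(multi-stack) Turing machine in time polynomial in the length of the encoded input. -/
def DecidableInPolyTime {α Γ : Type} (enc : α → List Γ) (P : α → Prop) : Prop :=
  ∃ f : α → Bool, (∀ x : α, f x = true ↔ P x) ∧
    Nonempty (Turing.TM2ComputableInPolyTime enc Computability.encodeBool f)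

end Monitorability

/-! Part (2) rests on determinism. If the finite word `x` leads from the initial state to `q`, then
`x w` is accepted exactly when `w` is accepted from `q`, so `x` is a good or bad prefix exactly when
the language of `q` is universal or empty. In a complete automaton every word leads to a state, and
the reachable states are exactly those so obtained; the quantifiers over words therefore become
quantifiers over reachable states (`IsComplete.monitorable_iff`). A trap state has empty language,
so under the extra hypothesis "empty" and "trap" agree on reachable states.

For part (1), a rejecting sink makes the automaton complete without changing its language. Emptiness
and universality then depend only on the graph of the automaton: the language of `q` is nonempty iff
some infinite path from `q` visits accepting states infinitely often, and non-universal iff `q`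
reaches the start of an infinite path that avoids them. Both sets, as well as reachability, are
obtained by iterating monotone operators on sets of states. Each iteration changes a counting
measure strictly until it stabilises, so as many rounds as there are states suffice. The initial
state must not reach a state from which neither an empty nor a universal state is reachable;
`badStates` computes the states that do reach one.

The complexity bound comes from running these iterations on stacks of bits. Programs with loops are
compiled to Turing machines (`exec_code`) at no cost in steps. One predecessor computation is linear
in the transition table, and the deepest nesting is a reachability iteration inside a greatest fixed
point iteration, so the time is cubic. -/

namespace Monitorability

open Turing Function Relation

/-! ### Structured stack programs and their compilation to Turing machines -/

/-- Structured programs over finitely many stacks of bits. -/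
inductive StackProgram (K : Type) : Type
  /-- Push a bit. -/
  | push (k : K) (b : Bool) : StackProgram K
  /-- Run one program after the other. -/
  | seq (c d : StackProgram K) : StackProgram K
  /-- Pop a stack and continue according to the bit found, if any. -/
  | pop (k : K) (c : Option Bool → StackProgram K) : StackProgram K
  /-- Repeat a program while the top of a stack passes a test. -/
  | loop (k : K) (g : Option Bool → Bool) (c : StackProgram K) : StackProgram K
  /-- Do nothing. -/
  | skip : StackProgram K

namespace StackProgram

variable {K : Type}

/-- `Exec c s s' t`: started with the stacks `s`, the program `c` ends with the stacks `s'` after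
`t` steps. -/
inductive Exec [DecidableEq K] :
    StackProgram K → (K → List Bool) → (K → List Bool) → ℕ → Prop
  | push (k : K) (b : Bool) (s : K → List Bool) : Exec (push k b) s (update s k (b :: s k)) 1
  | seq {c d : StackProgram K} {s s' s'' : K → List Bool} {t t' : ℕ} :
      Exec c s s' t → Exec d s' s'' t' → Exec (seq c d) s s'' (t + t')
  | pop {k : K} {c : Option Bool → StackProgram K} {s s' : K → List Bool} {t : ℕ} :
      Exec (c (s k).head?) (update s k (s k).tail) s' t → Exec (pop k c) s s' (t + 1)
  | loop_exit {k : K} {g : Option Bool → Bool} {c : StackProgram K} {s : K → List Bool} :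
      g (s k).head? = false → Exec (loop k g c) s s 1
  | loop_step {k : K} {g : Option Bool → Bool} {c : StackProgram K} {s s' s'' : K → List Bool}
      {t t' : ℕ} : g (s k).head? = true → Exec c s s' t → Exec (loop k g c) s' s'' t' →
      Exec (loop k g c) s s'' (t + t' + 1)
  | skip (s : K → List Bool) : Exec skip s s 1

/-- The control points of a program. -/
def Label : StackProgram K → Type
  | push _ _ => Unit
  | seq c d => Label c ⊕ Label d
  | pop _ c => Option ((o : Option Bool) × Label (c o))
  | loop _ _ c => Option (Label c)
  | skip => Unit

/-- There are finitely many control points. -/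
@[reducible]
def fintypeLabel : (c : StackProgram K) → Fintype (Label c)
  | push _ _ => inferInstanceAs (Fintype Unit)
  | seq c d =>
    have := fintypeLabel c
    have := fintypeLabel d
    inferInstanceAs (Fintype (Label c ⊕ Label d))
  | pop _ c =>
    have := fun o => fintypeLabel (c o)
    inferInstanceAs (Fintype (Option ((o : Option Bool) × Label (c o))))
  | loop _ _ c =>
    have := fintypeLabel c
    inferInstanceAs (Fintype (Option (Label c)))
  | skip => inferInstanceAs (Fintype Unit)

/-- The control point at which a program starts. -/
def entry : (c : StackProgram K) → Label c
  | push _ _ => ()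
  | seq c _ => Sum.inl (entry c)
  | pop _ _ => none
  | loop _ _ _ => none
  | skip => ()

/-- The Turing machine instruction at a control point, where `emb` names the control points in the
machine and `exit` is the label at which the machine goes on after the program. -/
def code {Λ : Type} : (c : StackProgram K) → (Label c → Λ) → Λ → Label c →
    TM2.Stmt (fun _ : K => Bool) Λ (Option Bool)
  | push k b, _, exit, _ => .push k (fun _ => b) (.goto fun _ => exit)
  | seq c d, emb, exit, l =>
    match l with
    | Sum.inl l => code c (fun l => emb (Sum.inl l)) (emb (Sum.inr (entry d))) l
    | Sum.inr l => code d (fun l => emb (Sum.inr l)) exit l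
  | pop k c, emb, exit, l =>
    match l with
    | none => .pop k (fun _ o => o) (.goto fun v => emb (some ⟨v, entry (c v)⟩))
    | some ⟨o, l⟩ => code (c o) (fun l => emb (some ⟨o, l⟩)) exit l
  | loop k g c, emb, exit, l =>
    match l with
    | none => .peek k (fun _ o => o) (.goto fun v => bif g v then emb (some (entry c)) else exit)
    | some l => code c (fun l => emb (some l)) (emb none) l
  | skip, _, exit, _ => .goto fun _ => exit

variable [DecidableEq K]

/-- Induction on the execution: each unit of its step count is one machine step. Keeping `emb` and
`exit` general lets a subprogram be treated as part of the same machine. The register `v` is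
arbitrary because every branch tests a bit read in that very step. -/
theorem exec_code {Λ : Type} (M : Λ → TM2.Stmt (fun _ : K => Bool) Λ (Option Bool))
    {c : StackProgram K} {s s' : K → List Bool} {t : ℕ} (h : Exec c s s' t)
    (emb : Label c → Λ) (exit : Λ) (hM : ∀ l, M (emb l) = code c emb exit l) (v : Option Bool) :
    ∃ v', (flip bind (TM2.step M))^[t] (some ⟨some (emb (entry c)), v, s⟩) =
      some ⟨some exit, v', s'⟩ := by
  induction h generalizing exit v with
  | push k b s => exact ⟨v, congrArg (fun q => some (TM2.stepAux q v s)) (hM ())⟩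
  | @seq c d s s' s'' t t' _ _ ih₁ ih₂ =>
    obtain ⟨v₁, h₁⟩ := ih₁ (fun l => emb (Sum.inl l)) (emb (Sum.inr (entry d)))
      (fun l => hM (Sum.inl l)) v
    obtain ⟨v₂, h₂⟩ := ih₂ (fun l => emb (Sum.inr l)) exit (fun l => hM (Sum.inr l)) v₁
    refine ⟨v₂, ?_⟩
    rw [add_comm, iterate_add_apply]
    exact (congrArg _ h₁).trans h₂
  | @pop k c s s' t _ ih =>
    obtain ⟨v₁, h₁⟩ := ih (fun l => emb (some ⟨_, l⟩)) exit (fun l => hM (some ⟨_, l⟩)) (s k).head?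
    refine ⟨v₁, ?_⟩
    rw [iterate_succ_apply]
    refine (congrArg _ ?_).trans h₁
    exact congrArg (fun q => some (TM2.stepAux q v s)) (hM none)
  | @loop_exit k g c s hg =>
    refine ⟨(s k).head?, ?_⟩
    refine (congrArg (fun q => some (TM2.stepAux q v s)) (hM none)).trans ?_
    simp [code, hg]
  | @loop_step k g c s s' s'' t t' hg _ _ ih₁ ih₂ =>
    obtain ⟨v₁, h₁⟩ := ih₁ (fun l => emb (some l)) (emb none) (fun l => hM (some l)) (s k).head?
    obtain ⟨v₂, h₂⟩ := ih₂ emb exit hM v₁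
    refine ⟨v₂, ?_⟩
    rw [iterate_succ_apply, add_comm, iterate_add_apply]
    refine (congrArg _ ((congrArg _ ?_).trans h₁)).trans h₂
    refine (congrArg (fun q => some (TM2.stepAux q v s)) (hM none)).trans ?_
    simp [code, hg]
  | skip s => exact ⟨v, congrArg (fun q => some (TM2.stepAux q v s)) (hM ())⟩

/-- The Turing machine that runs a program and then halts. -/
def toFinTM2 [Fintype K] (c : StackProgram K) (inp out : K) : FinTM2 where
  K := K
  k₀ := inp
  k₁ := out
  Γ _ := Bool
  Λ := Option (Label c)
  main := some (entry c)
  ΛFin := have := fintypeLabel c; inferInstance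
  σ := Option Bool
  initialState := none
  Γk₀Fin := inferInstanceAs (Fintype Bool)
  m
    -- A halting configuration must carry the initial register value, hence the reset. This final
    -- step is the `+ 1` in the time bound.
    | none => .load (fun _ => none) .halt
    | some l => code c some none l

/-- A function computed by a structured program in polynomial time is computed by a Turing machine
in polynomial time. -/
theorem computableInPolyTime [Fintype K] {α : Type} (enc : α → List Bool) (f : α → Bool)
    (c : StackProgram K) (inp out : K) (p : Polynomial ℕ)
    (h : ∀ x, ∃ t ≤ p.eval (enc x).length,
      Exec c (update (fun _ => []) inp (enc x)) (update (fun _ => []) out [f x]) t) :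
    Nonempty (TM2ComputableInPolyTime enc Computability.encodeBool f) := by
  choose t ht hrun using h
  refine ⟨{ tm := c.toFinTM2 inp out, inputAlphabet := Equiv.refl _,
            outputAlphabet := Equiv.refl _, time := p + 1, outputsFun := fun x => ?_ }⟩
  refine ⟨⟨t x + 1, ?_⟩, by simpa using ht x⟩
  obtain ⟨v, hv⟩ := exec_code (c.toFinTM2 inp out).m (hrun x) some none (fun _ => rfl) none
  have h0 : initList (c.toFinTM2 inp out) (List.map (Equiv.refl Bool).invFun (enc x)) =
      ⟨some (some (entry c)), none, update (fun _ => []) inp (enc x)⟩ := by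
    refine congrArg (TM2.Cfg.mk _ _) (funext fun k => ?_)
    by_cases hk : k = inp
    · replace hk := hk.symm
      subst hk
      refine (dif_pos rfl).trans ((List.map_id _).trans ?_)
      exact (update_self (β := fun _ => List Bool) inp (enc x) fun _ => []).symm
    · exact (dif_neg hk).trans (update_of_ne (β := fun _ => List Bool) hk (enc x) fun _ => []).symm
  have h1 : haltList (c.toFinTM2 inp out) (List.map (Equiv.refl Bool).invFun
      (Computability.encodeBool (f x))) = ⟨none, none, update (fun _ => []) out [f x]⟩ := by
    refine congrArg (TM2.Cfg.mk _ _) (funext fun k => ?_)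
    by_cases hk : k = out
    · replace hk := hk.symm
      subst hk
      refine (dif_pos rfl).trans ((List.map_id _).trans ?_)
      exact (update_self (β := fun _ => List Bool) out [f x] fun _ => []).symm
    · exact (dif_neg hk).trans (update_of_ne (β := fun _ => List Bool) hk [f x] fun _ => []).symm
  rw [iterate_succ_apply']
  refine (congrArg _ ((congrArg _ (congrArg some h0)).trans hv)).trans ?_
  exact (congrArg some h1.symm)

end StackProgram

open StackProgram


/-! ### The memory of the decision procedure -/

/-- The stacks of the decision procedure: the input, the answer, two copies of the number of
states, the number of symbols, the initial state, the transition table, the accepting states, a set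
of states, the set of its predecessors, a further set of states, and auxiliary stacks. -/
inductive Reg
  | inp | out | n₁ | n₁' | n₂ | n₂' | m | m' | q | t | t' | r | acc | f | f' | y | y' | w | w' | u
  deriving DecidableEq

instance : Fintype Reg where
  elems := {.inp, .out, .n₁, .n₁', .n₂, .n₂', .m, .m', .q, .t, .t', .r, .acc, .f, .f', .y, .y', .w,
    .w', .u}
  complete k := by cases k <;> decide

/-- The contents of the stacks of the decision procedure. -/
@[ext]
structure Mem where
  inp : List Bool := []
  out : List Bool := []
  n₁ : List Bool := []
  n₁' : List Bool := []
  n₂ : List Bool := []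
  n₂' : List Bool := []
  m : List Bool := []
  m' : List Bool := []
  q : List Bool := []
  t : List Bool := []
  t' : List Bool := []
  r : List Bool := []
  acc : List Bool := []
  f : List Bool := []
  f' : List Bool := []
  y : List Bool := []
  y' : List Bool := []
  w : List Bool := []
  w' : List Bool := []
  u : List Bool := []

namespace Mem

/-- The contents of a stack. -/
def get (s : Mem) : Reg → List Bool
  | .inp => s.inp | .out => s.out | .n₁ => s.n₁ | .n₁' => s.n₁' | .n₂ => s.n₂ | .n₂' => s.n₂'
  | .m => s.m | .m' => s.m' | .q => s.q | .t => s.t | .t' => s.t' | .r => s.r | .acc => s.acc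
  | .f => s.f | .f' => s.f' | .y => s.y | .y' => s.y' | .w => s.w | .w' => s.w' | .u => s.u

/-- Replace the contents of a stack. -/
def set (s : Mem) (k : Reg) (l : List Bool) : Mem :=
  match k with
  | .inp => { s with inp := l } | .out => { s with out := l }
  | .n₁ => { s with n₁ := l } | .n₁' => { s with n₁' := l }
  | .n₂ => { s with n₂ := l } | .n₂' => { s with n₂' := l }
  | .m => { s with m := l } | .m' => { s with m' := l }
  | .q => { s with q := l } | .t => { s with t := l } | .t' => { s with t' := l }
  | .r => { s with r := l } | .acc => { s with acc := l }
  | .f => { s with f := l } | .f' => { s with f' := l }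
  | .y => { s with y := l } | .y' => { s with y' := l }
  | .w => { s with w := l } | .w' => { s with w' := l } | .u => { s with u := l }

theorem get_set (s : Mem) (k : Reg) (l : List Bool) : (s.set k l).get = update s.get k l := by
  cases k <;> funext k' <;> cases k' <;> rfl

/-- Reduces identities between memories to identities between functions, where the rules for
`update` apply. -/
theorem get_injective : Injective get := by
  intro s s' h
  have h' : ∀ k, s.get k = s'.get k := fun k => congrFun h k
  exact Mem.ext (h' .inp) (h' .out) (h' .n₁) (h' .n₁') (h' .n₂) (h' .n₂') (h' .m) (h' .m') (h' .q)
    (h' .t) (h' .t') (h' .r) (h' .acc) (h' .f) (h' .f') (h' .y) (h' .y') (h' .w) (h' .w') (h' .u)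

@[simp]
theorem get_set_self (s : Mem) (k : Reg) (l : List Bool) : (s.set k l).get k = l := by
  rw [get_set, update_self]

theorem get_set_of_ne (s : Mem) {k k' : Reg} (h : k' ≠ k) (l : List Bool) :
    (s.set k l).get k' = s.get k' := by
  rw [get_set, update_of_ne h]

@[simp]
theorem set_set (s : Mem) (k : Reg) (l l' : List Bool) : (s.set k l).set k l' = s.set k l' :=
  get_injective (by simp [get_set])

@[simp]
theorem set_get (s : Mem) (k : Reg) : s.set k (s.get k) = s :=
  get_injective (by simp [get_set])

theorem set_comm (s : Mem) {k k' : Reg} (h : k ≠ k') (l l' : List Bool) :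
    (s.set k l).set k' l' = (s.set k' l').set k l :=
  get_injective (by simp only [get_set]; exact update_comm h _ _ _)

end Mem

/-- `Run c s s' t`: the program `c` takes the memory `s` to the memory `s'` in at most `t`
steps. -/
def Run (c : StackProgram Reg) (s s' : Mem) (t : ℕ) : Prop :=
  ∃ t' ≤ t, Exec c s.get s'.get t'

namespace Run

variable {c d : StackProgram Reg} {s s' s'' : Mem} {t t' : ℕ}

theorem mono (h : Run c s s' t) (ht : t ≤ t') : Run c s s' t' :=
  let ⟨t₀, h₀, h⟩ := h
  ⟨t₀, h₀.trans ht, h⟩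

theorem push (k : Reg) (b : Bool) (s : Mem) : Run (.push k b) s (s.set k (b :: s.get k)) 1 :=
  ⟨1, le_rfl, Mem.get_set s k _ ▸ Exec.push k b s.get⟩

theorem skip (s : Mem) : Run .skip s s 1 :=
  ⟨1, le_rfl, Exec.skip _⟩

theorem seq (h : Run c s s' t) (h' : Run d s' s'' t') : Run (.seq c d) s s'' (t + t') :=
  let ⟨_, h₀, h⟩ := h
  let ⟨_, h₀', h'⟩ := h'
  ⟨_, Nat.add_le_add h₀ h₀', h.seq h'⟩

theorem pop {k : Reg} {c : Option Bool → StackProgram Reg}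
    (h : Run (c (s.get k).head?) (s.set k (s.get k).tail) s' t) : Run (.pop k c) s s' (t + 1) :=
  let ⟨_, h₀, h⟩ := h
  ⟨_, Nat.add_le_add_right h₀ 1, Exec.pop (Mem.get_set s k _ ▸ h)⟩

theorem loop_exit {k : Reg} {g : Option Bool → Bool} (h : g (s.get k).head? = false) :
    Run (.loop k g c) s s 1 :=
  ⟨1, le_rfl, Exec.loop_exit h⟩

theorem loop_step {k : Reg} {g : Option Bool → Bool} (h : g (s.get k).head? = true)
    (hc : Run c s s' t) (hl : Run (.loop k g c) s' s'' t') :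
    Run (.loop k g c) s s'' (t + t' + 1) :=
  let ⟨_, h₀, hc⟩ := hc
  let ⟨_, h₀', hl⟩ := hl
  ⟨_, by omega, Exec.loop_step h hc hl⟩

end Run

/-! ### Loop constructs and their running times -/

/-- Pop a stack until it is empty, running a program for each bit. -/
def forEach (k : Reg) (c : Bool → StackProgram Reg) : StackProgram Reg :=
  .loop k Option.isSome (.pop k fun o => c (o.getD false))

/-- Pop a block `1 ⋯ 1 0` from a stack, running a program for each `1`. -/
def forBlock (k : Reg) (c : StackProgram Reg) : StackProgram Reg :=
  .seq (.loop k (fun o => o.getD false) (.pop k fun _ => c)) (.pop k fun _ => .skip)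

/-- Move the contents of a stack onto another one, in reverse order. -/
def move (a b : Reg) : StackProgram Reg :=
  forEach a (.push b)

/-- Run a program once for each entry of the stack `k`, using the auxiliary stack `k'`. -/
def times (k k' : Reg) (c : StackProgram Reg) : StackProgram Reg :=
  .seq (forEach k fun b => .seq (.push k' b) c) (move k' k)

namespace Run

variable {s s' s'' : Mem} {k : Reg} {t t' : ℕ}

theorem forEach_nil {c : Bool → StackProgram Reg} (h : s.get k = []) :
    Run (forEach k c) s s 1 :=
  loop_exit (by rw [h]; rfl)

theorem forEach_cons {c : Bool → StackProgram Reg} {b : Bool} {l : List Bool}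
    (h : s.get k = b :: l) (hc : Run (c b) (s.set k l) s' t) (hl : Run (forEach k c) s' s'' t') :
    Run (forEach k c) s s'' (t + t' + 2) :=
  (loop_step (by rw [h]; rfl) (pop (by rw [h]; exact hc)) hl).mono (by omega)

/-- `S i` is the memory after `i` rounds, apart from the stack `k`. The body has to work for any
remainder `l'` on `k`, so it cannot depend on the input still to be read. Each round adds a test and
a pop to the cost of the body. -/
theorem forBlock {c : StackProgram Reg} (τ : ℕ) (S : ℕ → Mem) (l : List Bool) (j : ℕ)
    (hS : ∀ i < j, ∀ l', Run c ((S i).set k l') ((S (i + 1)).set k l') τ) :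
    Run (forBlock k c) ((S 0).set k (unary j ++ l)) ((S j).set k l) (j * (τ + 2) + 3) := by
  have hloop : ∀ j (S : ℕ → Mem),
      (∀ i < j, ∀ l', Run c ((S i).set k l') ((S (i + 1)).set k l') τ) →
      Run (.loop k (fun o => o.getD false) (.pop k fun _ => c)) ((S 0).set k (unary j ++ l))
        ((S j).set k (false :: l)) (j * (τ + 2) + 1) := by
    intro j
    induction j with
    | zero => exact fun S _ => (loop_exit (by simp [unary])).mono (by omega)
    | succ j ih =>
      intro S hS
      have h0 := hS 0 (Nat.succ_pos j) (unary j ++ l)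
      have h1 := ih (fun i => S (i + 1)) fun i hi => hS (i + 1) (Nat.succ_lt_succ hi)
      refine (loop_step (by simp [unary, List.replicate_succ]) (pop ?_) h1).mono
        (t := (τ + 1) + (j * (τ + 2) + 1) + 1) (by ring_nf; omega)
      simpa [unary, List.replicate_succ] using h0
  refine (seq (hloop j S hS) (pop ?_)).mono (t := (j * (τ + 2) + 1) + (1 + 1)) (by omega)
  simpa using skip ((S j).set k l)

theorem move {a b : Reg} (hab : a ≠ b) (s : Mem) (l : List Bool) (h : s.get a = l) :
    Run (move a b) s ((s.set a []).set b (l.reverse ++ s.get b)) (3 * l.length + 1) := by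
  induction l generalizing s with
  | nil =>
    have h' := forEach_nil (c := .push b) h
    have e : (s.set a []).set b ([].reverse ++ s.get b) = s := by
      rw [← h, Mem.set_get, h]; exact Mem.set_get s b
    rw [e]
    exact h'
  | cons x l ih =>
    have h1 := Run.push b x (s.set a l)
    have h2 := ih ((s.set a l).set b (x :: (s.set a l).get b))
      (by rw [Mem.get_set_of_ne _ hab, Mem.get_set_self])
    refine (forEach_cons h h1 (s'' := (s.set a []).set b ((x :: l).reverse ++ s.get b)) ?_).mono
      (t := 1 + (3 * l.length + 1) + 2) (by simp; omega)
    change Run (Monitorability.move a b) _ _ _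
    convert h2 using 1
    rw [Mem.get_set_self, Mem.set_comm _ hab.symm, Mem.set_set, Mem.set_set,
      Mem.get_set_of_ne _ hab.symm]
    simp

/-- Draining `k` onto `k'` reverses it and moving it back restores it, so the counter can be reused.
Per entry, test, pop and push cost 3 steps and the way back another 3. -/
theorem times {k k' : Reg} (hk : k ≠ k') {c : StackProgram Reg} (τ : ℕ) (l : List Bool)
    (S : ℕ → Mem) (hS : ∀ i < l.length, ∀ a b,
      Run c (((S i).set k a).set k' b) (((S (i + 1)).set k a).set k' b) τ) :
    Run (times k k' c) (((S 0).set k l).set k' []) (((S l.length).set k l).set k' [])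
      (l.length * (τ + 6) + 2) := by
  have hloop : ∀ (l l' : List Bool) (S : ℕ → Mem), (∀ i < l.length, ∀ a b,
      Run c (((S i).set k a).set k' b) (((S (i + 1)).set k a).set k' b) τ) →
      Run (forEach k fun b => .seq (.push k' b) c) (((S 0).set k l).set k' l')
        (((S l.length).set k []).set k' (l.reverse ++ l')) (l.length * (τ + 3) + 1) := by
    intro l
    induction l with
    | nil =>
      intro l' S _
      exact (forEach_nil (by rw [Mem.get_set_of_ne _ hk, Mem.get_set_self])).mono (by omega)
    | cons x l ih =>
      intro l' S hS
      have h1 := Run.push k' x ((((S 0).set k (x :: l)).set k' l').set k l)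
      have h2 := hS 0 (by simp) l (x :: l')
      have h3 := ih (x :: l') (fun i => S (i + 1)) fun i hi => hS (i + 1) (by simpa using hi)
      rw [Mem.get_set_of_ne _ hk.symm, Mem.get_set_self, Mem.set_comm _ hk.symm, Mem.set_set,
        Mem.set_set] at h1
      refine (forEach_cons (b := x) (l := l) (by rw [Mem.get_set_of_ne _ hk, Mem.get_set_self])
        (seq ?_ h2) ?_).mono (t := (1 + τ) + (l.length * (τ + 3) + 1) + 2) ?_
      · rw [Mem.set_comm _ hk.symm, Mem.set_set]
        exact h1
      · convert h3 using 1
        simp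
      · simp only [List.length_cons]; ring_nf; omega
  have h1 := hloop l [] S hS
  have h2 := Run.move hk.symm (((S l.length).set k []).set k' (l.reverse ++ [])) l.reverse (by simp)
  refine (seq h1 (s'' := ((S l.length).set k l).set k' []) ?_).mono
    (t := (l.length * (τ + 3) + 1) + (3 * l.reverse.length + 1)) ?_
  · convert h2 using 1
    rw [Mem.set_set, Mem.get_set_of_ne _ hk, Mem.get_set_self, Mem.set_comm _ hk.symm,
      Mem.set_set]
    simp
  · simp only [List.length_reverse]; ring_nf; omega

end Run

/-! ### Scanning the transition table for predecessors -/

/-- The table entry `k`, for scanning: `11` for each unit, then `10`. -/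
def entryBits (k : ℕ) : List Bool :=
  List.replicate (2 * k + 1) true ++ [false]

/-- A row of the table, for scanning: its entries, then `0`. -/
def rowBits (r : List ℕ) : List Bool :=
  r.flatMap entryBits ++ [false]

/-- The table, for scanning. -/
def tableBits (rows : List (List ℕ)) : List Bool :=
  rows.flatMap rowBits

/-- Go to the next state in the list of states. -/
def advance : StackProgram Reg :=
  .seq (.push .t' true) (.pop .y fun o => o.elim .skip fun b => .push .r b)

/-- Set the accumulator if the present state belongs to the set, and go back to the first state. -/
def lookup : StackProgram Reg :=
  .seq (.push .t' false)
    (.seq (.pop .y fun o => o.elim .skip fun b =>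
        .seq (.push .y b) (bif b then .seq (.pop .acc fun _ => .skip) (.push .acc true) else .skip))
      (move .r .y))

/-- Process a bit of the table. -/
def scanBit (b : Bool) : StackProgram Reg :=
  bif b then .seq (.push .t' true) (.pop .t fun o => bif o.getD false then advance else lookup)
  else .seq (.push .t' false) (.pop .acc fun o => .push .w' o.isSome)

/-- Compute the set of predecessors. -/
def pre : StackProgram Reg :=
  .seq (forEach .t scanBit) (.seq (move .t' .t) (move .w' .w))

/-- The accumulator as a stack. -/
def accBits (b : Bool) : List Bool :=
  bif b then [true] else []

namespace Run

variable {s'' : Mem} {T : ℕ}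

theorem push_then {c : StackProgram Reg} {s : Mem} {k : Reg} {b : Bool}
    (h : Run c (s.set k (b :: s.get k)) s'' T) : Run (.seq (.push k b) c) s s'' (T + 1) :=
  ((push k b s).seq h).mono (by omega)

/-- Stated backwards: the run of the rest of the loop is a hypothesis, so that the lemmas for units,
entries and rows chain together although all of them describe portions of one loop. -/
theorem scan_advance (k : ℕ) (s : Mem) (l t' y r : List Bool)
    (h : Run (forEach .t scanBit) { s with
      t := l
      t' := List.replicate (2 * k) true ++ t'
      y := y.drop k
      r := (y.take k).reverse ++ r } s'' T) :
    Run (forEach .t scanBit) { s with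
      t := List.replicate (2 * k) true ++ l
      t' := t'
      y := y
      r := r } s'' (T + 7 * k) := by
  induction k generalizing t' y r with
  | zero => simpa using h
  | succ k ih =>
    have e : ∀ l : List Bool, List.replicate (2 * (k + 1)) true ++ l =
        true :: true :: (List.replicate (2 * k) true ++ l) := fun l => rfl
    have e' : ∀ l : List Bool, List.replicate (2 * (k + 1)) true ++ l =
        List.replicate (2 * k) true ++ true :: true :: l := by
      intro l
      rw [show 2 * (k + 1) = 2 * k + 2 by ring, List.replicate_add]
      simp
    rw [e l]
    rw [e' t'] at h
    have body : Run (scanBit true)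
        { s with t := true :: (List.replicate (2 * k) true ++ l), t' := t', y := y, r := r }
        { s with
          t := List.replicate (2 * k) true ++ l
          t' := true :: true :: t'
          y := y.tail
          r := (y.take 1).reverse ++ r } 5 := by
      refine push_then (pop ?_)
      dsimp only [Mem.set, Mem.get]
      refine push_then (pop ?_)
      dsimp only [Mem.set, Mem.get]
      cases y with
      | nil => exact skip _
      | cons b y => exact push _ _ _
    have h1 := ih (true :: true :: t') y.tail ((y.take 1).reverse ++ r)
      (by cases y <;> simpa using h)
    exact (forEach_cons rfl body h1).mono (by omega)

theorem scan_lookup (s : Mem) (l t' y r : List Bool) (a : Bool)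
    (h : Run (forEach .t scanBit) { s with
      t := l
      t' := false :: true :: t'
      y := r.reverse ++ y
      r := []
      acc := accBits (a || y.head?.getD false) } s'' T) :
    Run (forEach .t scanBit) { s with
      t := true :: false :: l
      t' := t'
      y := y
      r := r
      acc := accBits a } s'' (T + 3 * r.length + 12) := by
  have body : Run (scanBit true)
      { s with t := false :: l, t' := t', y := y, r := r, acc := accBits a }
      { s with
        t := l
        t' := false :: true :: t'
        y := r.reverse ++ y
        r := []
        acc := accBits (a || y.head?.getD false) } (3 * r.length + 10) := by
    refine push_then (pop ?_)
    dsimp only [Mem.set, Mem.get]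
    refine push_then (Run.mono (t := 6 + (3 * r.length + 1)) (seq (s' := { s with
        t := l
        t' := false :: true :: t'
        y := y
        r := r
        acc := accBits (a || y.head?.getD false) }) (pop ?_)
      (move (by decide) _ r rfl)) (by omega))
    dsimp only [Mem.set, Mem.get]
    rcases y with - | ⟨b, y⟩
    · rw [show (a || ([] : List Bool).head?.getD false) = a by simp]
      exact (skip _).mono (by omega)
    · refine push_then ?_
      dsimp only [Mem.set, Mem.get]
      rw [show (a || (b :: y).head?.getD false) = (a || b) by simp]
      cases b with
      | false =>
        rw [Bool.or_false]
        exact (skip _).mono (by omega)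
      | true =>
        rw [Bool.or_true]
        -- Popping before pushing keeps at most one bit on the accumulator.
        refine Run.mono (t := 2 + 1) (seq (pop (skip _)) ?_) (by omega)
        cases a <;> exact push _ _ _
  exact (forEach_cons rfl body h).mono (by omega)

/-- The units of the entry move `k` bits from `y` to `r`, which exposes the bit of state `k`; the
lookup then restores `y`. An entry has `2 * k + 2` bits, and the cost, at most `10 * k + 12`, is
covered by 6 steps per bit. -/
theorem scan_entry (k : ℕ) (s : Mem) (l t' y : List Bool) (a : Bool)
    (h : Run (forEach .t scanBit) { s with
      t := l
      t' := (entryBits k).reverse ++ t'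
      y := y
      r := []
      acc := accBits (a || y[k]?.getD false) } s'' T) :
    Run (forEach .t scanBit) { s with
      t := entryBits k ++ l
      t' := t'
      y := y
      r := []
      acc := accBits a } s'' (T + 6 * (entryBits k).length) := by
  have h1 := scan_lookup (T := T) s l (List.replicate (2 * k) true ++ t') (y.drop k)
    ((y.take k).reverse ++ []) a (by
      have e : (entryBits k).reverse ++ t' =
          false :: true :: (List.replicate (2 * k) true ++ t') := by
        simp only [entryBits, List.reverse_append, List.reverse_replicate]
        rfl
      rw [e] at h
      simpa using h)
  have h2 := scan_advance k { s with acc := accBits a } (true :: false :: l) t' y [] h1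
  rw [show entryBits k ++ l = List.replicate (2 * k) true ++ true :: false :: l by
    simp [entryBits, List.replicate_succ']]
  refine h2.mono ?_
  simp [entryBits]
  omega

theorem scan_entries (es : List ℕ) (s : Mem) (l t' y : List Bool) (a : Bool)
    (h : Run (forEach .t scanBit) { s with
      t := l
      t' := (es.flatMap entryBits).reverse ++ t'
      y := y
      r := []
      acc := accBits (a || es.any fun k => y[k]?.getD false) } s'' T) :
    Run (forEach .t scanBit) { s with
      t := es.flatMap entryBits ++ l
      t' := t'
      y := y
      r := []
      acc := accBits a } s'' (T + 6 * (es.flatMap entryBits).length) := by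
  induction es generalizing t' a with
  | nil => simpa using h
  | cons k es ih =>
    have h1 := ih ((entryBits k).reverse ++ t') (a || y[k]?.getD false)
      (by simpa [Bool.or_assoc] using h)
    have h2 := scan_entry k s (es.flatMap entryBits ++ l) t' y a h1
    rw [List.flatMap_cons, List.append_assoc]
    refine h2.mono ?_
    simp
    omega

theorem scan_rows (rows : List (List ℕ)) (s : Mem) (l t' y w' : List Bool)
    (h : Run (forEach .t scanBit) { s with
      t := l
      t' := (tableBits rows).reverse ++ t'
      y := y
      r := []
      acc := []
      w' := (rows.map fun es => es.any fun k => y[k]?.getD false).reverse ++ w' } s'' T) :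
    Run (forEach .t scanBit) { s with
      t := tableBits rows ++ l
      t' := t'
      y := y
      r := []
      acc := []
      w' := w' } s'' (T + 6 * (tableBits rows).length) := by
  induction rows generalizing t' w' with
  | nil => simpa [tableBits] using h
  | cons es rows ih =>
    have h1 := ih ((rowBits es).reverse ++ t') ((es.any fun k => y[k]?.getD false) :: w')
      (by simpa [tableBits] using h)
    have h2 : Run (forEach .t scanBit) { s with
        t := false :: (tableBits rows ++ l)
        t' := (es.flatMap entryBits).reverse ++ t'
        y := y
        r := []
        acc := accBits (false || es.any fun k => y[k]?.getD false)
        w' := w' } s'' (T + 6 * (tableBits rows).length + 6) := by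
      rw [Bool.false_or]
      generalize (es.any fun k => y[k]?.getD false) = a at h1 ⊢
      have body : Run (scanBit false)
          { s with
            t := tableBits rows ++ l
            t' := (es.flatMap entryBits).reverse ++ t'
            y := y
            r := []
            acc := accBits a
            w' := w' }
          { s with
            t := tableBits rows ++ l
            t' := (rowBits es).reverse ++ t'
            y := y
            r := []
            acc := []
            w' := a :: w' } 4 := by
        refine push_then (pop ?_)
        dsimp only [Mem.set, Mem.get]
        rw [show (rowBits es).reverse ++ t' = false :: ((es.flatMap entryBits).reverse ++ t') by
          simp [rowBits]]
        cases a <;> exact (push _ _ _).mono (by omega)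
      exact (forEach_cons rfl body h1).mono (by omega)
    have h3 := scan_entries es { s with w' := w' } _ t' y false h2
    have e : tableBits (es :: rows) ++ l =
        es.flatMap entryBits ++ false :: (tableBits rows ++ l) := by simp [tableBits, rowBits]
    rw [e]
    refine h3.mono ?_
    simp [tableBits, rowBits]
    omega

theorem pre (rows : List (List ℕ)) (s : Mem) (y : List Bool) :
    Run pre { s with
      t := tableBits rows, t' := [], y := y, r := [], acc := [], w := [], w' := [] } { s with
      t := tableBits rows, t' := [], y := y, r := [], acc := []
      w := rows.map fun es => es.any fun k => y[k]?.getD false, w' := [] }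
      (12 * (tableBits rows).length + 3) := by
  have h1 := scan_rows (T := 1) rows { s with w := [] } [] [] y [] (forEach_nil rfl)
  -- Each row contributes at least its end mark.
  have hl : rows.length ≤ (tableBits rows).length := by
    rw [tableBits, List.length_flatMap]
    refine (List.length_le_sum_of_one_le _ fun i hi => ?_).trans' (by simp)
    obtain ⟨r, _, rfl⟩ := List.mem_map.1 hi
    simp [rowBits]
  refine Run.mono (seq (by simpa using h1) (seq (move (by decide) _ (tableBits rows).reverse ?_)
    (t' := 3 * rows.length + 1) ?_)) (t := (1 + 6 * (tableBits rows).length) +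
      ((3 * (tableBits rows).reverse.length + 1) + (3 * rows.length + 1))) ?_
  · simp [Mem.get]
  · dsimp only [Mem.set, Mem.get]
    simpa [Mem.set, Mem.get] using move (a := .w') (b := .w) (by decide) { s with
      t := tableBits rows
      t' := []
      y := y
      r := []
      acc := []
      w := []
      w' := (rows.map fun es => es.any fun k => y[k]?.getD false).reverse } _ rfl
  · simp; omega

end Run

/-! ### The programs of the decision procedure -/

/-- Combine a set of states, a second one, which is used up, and the set of accepting states. -/
def zip (op : Bool → Bool → Bool → Bool) : StackProgram Reg :=
  .seq (forEach .y fun b => .pop .w fun c => .pop .f fun d =>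
      .seq (.push .f' (d.getD false)) (.push .y' (op b (c.getD false) (d.getD false))))
    (.seq (move .y' .y) (move .f' .f))

/-- Combine a set of states, the set of its predecessors, and the set of accepting states. -/
def step (op : Bool → Bool → Bool → Bool) : StackProgram Reg :=
  .seq pre (zip op)

/-- Add to a set of states all the states from which it can be reached. -/
def closure : StackProgram Reg :=
  times .n₂ .n₂' (step fun y w _ => y || w)

/-- Save the set of states, and replace it by the set of all states. -/
def save : StackProgram Reg :=
  .seq (forEach .y fun b => .seq (.push .u b) (.push .y' true)) (move .y' .y)

/-- Compute the set of the states from which no state with an empty or universal language can be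
reached, and all the states from which that set can be reached. -/
def decideSets : StackProgram Reg :=
  -- Greatest fixed point: states with an infinite path avoiding acceptance. Its closure gives the
  -- non-universal states.
  .seq (times .n₁ .n₁' (step fun _ w f => w && !f)) <|
  .seq closure <|
  .seq save <|
  -- Nested fixed point for the nonempty states. The inner closure runs on the counter `n₂`, which
  -- is why the number of states is stored twice.
  .seq (times .n₁ .n₁' (.seq (step fun _ w f => w && f) closure)) <|
  .seq (move .u .w) <|
  .seq (zip fun y w _ => !(y && w)) <|
  .seq closure <|
  -- Plain complementation; the predecessors computed by `step` are discarded.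
  .seq (step fun y _ _ => !y) closure

/-- Empty a stack. -/
def clear (k : Reg) : StackProgram Reg :=
  forEach k fun _ => .skip

/-- Answer whether the initial state lies outside the set of states, and empty the other stacks. -/
def answer : StackProgram Reg :=
  .seq (forEach .q fun _ => .pop .y fun _ => .skip) <|
  .seq (.pop .y fun o => .push .out (!(o.getD false))) <|
  .seq (clear .n₁) <| .seq (clear .n₂) <| .seq (clear .m) <| .seq (clear .t) <|
  .seq (clear .f) (clear .y)

/-- Read a table entry. -/
def parseEntry : StackProgram Reg :=
  .seq (forBlock .inp (.seq (.push .t' true) (.push .t' true)))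
    (.seq (.push .t' true) (.push .t' false))

/-- Read a row of the table and the preceding acceptance bit. -/
def parseRow (b : Bool) : StackProgram Reg :=
  .seq (.push .f' b) <| .seq (.push .y true) <| .seq (times .m .m' parseEntry) (.push .t' false)

/-- Read the input. -/
def parse : StackProgram Reg :=
  .seq (forBlock .inp (.seq (.push .n₁ true) (.push .n₂ true))) <|
  -- One more state, for the sink.
  .seq (.push .n₁ true) <| .seq (.push .n₂ true) <|
  .seq (forBlock .inp (.push .m true)) <|
  -- The sink has number 0, so the number of the initial state is shifted by one.
  .seq (forBlock .inp (.push .q true)) <| .seq (.push .q true) <|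
  -- The row of the sink: the entry 0, coded `10`, and the end mark `0`. The next two pushes make
  -- the sink non-accepting and a member of the initial full set.
  .seq (.push .t' true) <| .seq (.push .t' false) <| .seq (.push .t' false) <|
  .seq (.push .f' false) <| .seq (.push .y true) <|
  .seq (forEach .inp parseRow) <|
  .seq (move .t' .t) (move .f' .f)

/-- The decision procedure. -/
def decideMonitorable : StackProgram Reg :=
  .seq parse (.seq decideSets answer)

/-! ### The completed automaton as a table -/

namespace Instance

variable (I : Instance)

/-- The states of the completed automaton; `none` is the sink. -/
def states : List (Option (Fin I.numStates)) :=
  none :: (List.finRange I.numStates).map some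

/-- The successors of a state of the completed automaton. -/
def succs : Option (Fin I.numStates) → List (Option (Fin I.numStates))
  | none => [none]
  | some q => (List.finRange I.numSymbols).map (I.aut.step q)

/-- The accepting states of the completed automaton. -/
def acc : Option (Fin I.numStates) → Bool
  | none => false
  | some q => decide (q ∈ I.aut.accept)

/-- The set of the predecessors of a set of states. -/
def ex (Y : Option (Fin I.numStates) → Bool) (v : Option (Fin I.numStates)) : Bool :=
  (I.succs v).any Y

/-- The number of a state of the completed automaton. -/
def index : Option (Fin I.numStates) → ℕ
  | none => 0
  | some q => q.val + 1

/-- The transition table of the completed automaton. -/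
def rows : List (List ℕ) :=
  I.states.map fun v => (I.succs v).map I.index

theorem length_states : I.states.length = I.numStates + 1 := by
  simp [states]

theorem getElem?_states (Y : Option (Fin I.numStates) → Bool) (v : Option (Fin I.numStates)) :
    (I.states.map Y)[I.index v]? = some (Y v) := by
  cases v <;> simp [states, index]

/-- Links the bit-level scan to the predecessor operator `ex` on the graph. -/
theorem map_rows (Y : Option (Fin I.numStates) → Bool) :
    (I.rows.map fun es => es.any fun k => (I.states.map Y)[k]?.getD false) =
      I.states.map (I.ex Y) := by
  simp only [rows, List.map_map]
  refine List.map_congr_left fun v _ => ?_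
  simp only [comp_apply, List.any_map, ex]
  congr 1
  funext v
  simp only [comp_apply, getElem?_states, Option.getD_some]

/-- The memory of the decision procedure, with a set of states, a saved set of states and
counters. -/
def mem (Y : Option (Fin I.numStates) → Bool) (u a a' b b' : List Bool) : Mem where
  n₁ := a
  n₁' := a'
  n₂ := b
  n₂' := b'
  m := List.replicate I.numSymbols true
  q := List.replicate (I.aut.start.val + 1) true
  t := tableBits I.rows
  f := I.states.map I.acc
  y := I.states.map Y
  u := u

end Instance

/-! ### Correctness and running time of the set computations -/

namespace Run

variable {s s' s'' : Mem} {T : ℕ}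

theorem zip {V : Type} (op : Bool → Bool → Bool → Bool) (l : List V) (y w f : V → Bool) (s : Mem) :
    Run (zip op)
      { s with y := l.map y, y' := [], w := l.map w, f := l.map f, f' := [] }
      { s with y := l.map fun v => op (y v) (w v) (f v), y' := [], w := [], f := l.map f, f' := [] }
      (12 * l.length + 3) := by
  have hloop : ∀ (l : List V) (y' f' : List Bool), Run
      (forEach .y fun b => .pop .w fun c => .pop .f fun d =>
        .seq (.push .f' (d.getD false)) (.push .y' (op b (c.getD false) (d.getD false))))
      { s with y := l.map y, y' := y', w := l.map w, f := l.map f, f' := f' }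
      { s with
        y := []
        y' := (l.map fun v => op (y v) (w v) (f v)).reverse ++ y'
        w := []
        f := []
        f' := (l.map f).reverse ++ f' } (6 * l.length + 1) := by
    intro l
    induction l with
    | nil => exact fun y' f' => forEach_nil rfl
    | cons v l ih =>
      intro y' f'
      have h := ih (op (y v) (w v) (f v) :: y') (f v :: f')
      refine (forEach_cons (b := y v) (l := l.map y) rfl (s' := { s with
        y := l.map y
        y' := op (y v) (w v) (f v) :: y'
        w := l.map w
        f := l.map f
        f' := f v :: f' }) (pop (pop ?_)) ?_).mono (t := (2 + 1 + 1) + (6 * l.length + 1) + 2)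
          (by simp; omega)
      · dsimp only [Mem.set, Mem.get]
        exact push_then (push _ _ _)
      · simpa using h
  refine Run.mono (seq (hloop l [] []) (seq (move (by decide) _
    (l.map fun v => op (y v) (w v) (f v)).reverse ?_) (t' := 3 * l.length + 1) ?_))
    (t := (6 * l.length + 1) + ((3 * (l.map fun v => op (y v) (w v) (f v)).reverse.length + 1) +
      (3 * l.length + 1))) ?_
  · simp [Mem.get]
  · simpa [Mem.set, Mem.get] using move (a := .f') (b := .f) (by decide) { s with
      y := l.map fun v => op (y v) (w v) (f v)
      y' := []
      w := []
      f := []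
      f' := (l.map f).reverse } _ rfl
  · simp; omega

theorem clear (k : Reg) (s : Mem) : Run (clear k) s (s.set k []) (3 * (s.get k).length + 1) := by
  generalize h : s.get k = l
  induction l generalizing s with
  | nil =>
    rw [← h, Mem.set_get]
    exact (forEach_nil h).mono (by omega)
  | cons b l ih =>
    have h1 := ih (s.set k l) (by simp)
    rw [Mem.set_set] at h1
    exact (forEach_cons h (skip _) h1).mono (by simp; omega)

end Run

namespace Instance

variable (I : Instance) (u a a' b b' : List Bool) {B : ℕ}

theorem run_step (hB : I.numStates + 1 + (tableBits I.rows).length ≤ B)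
    (op : Bool → Bool → Bool → Bool) (Y : Option (Fin I.numStates) → Bool) :
    Run (step op) (I.mem Y u a a' b b') (I.mem (fun v => op (Y v) (I.ex Y v) (I.acc v)) u a a' b b')
      (18 * B) := by
  have h1 := Run.pre I.rows (I.mem Y u a a' b b') (I.states.map Y)
  rw [map_rows] at h1
  have h2 := Run.zip op I.states Y (I.ex Y) I.acc (I.mem Y u a a' b b')
  rw [length_states] at h2
  exact (h1.seq h2).mono (by omega)

theorem run_closure (hB : I.numStates + 1 + (tableBits I.rows).length ≤ B)
    (Y : Option (Fin I.numStates) → Bool) :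
    Run closure (I.mem Y u a a' (List.replicate (I.numStates + 1) true) [])
      (I.mem ((fun Y v => Y v || I.ex Y v)^[I.numStates + 1] Y) u a a'
        (List.replicate (I.numStates + 1) true) []) (26 * B ^ 2) := by
  have h := Run.times (k := .n₂) (k' := .n₂') (by decide) (c := step fun y w _ => y || w) (18 * B)
    (List.replicate (I.numStates + 1) true)
    (fun i => I.mem ((fun Y v => Y v || I.ex Y v)^[i] Y) u a a' [] []) fun i _ x x' => by
      rw [iterate_succ_apply']
      exact I.run_step u a a' x x' hB (fun y w _ => y || w) _
  rw [List.length_replicate] at h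
  refine Run.mono h ?_
  have hB' : I.numStates + 1 ≤ B := by omega
  nlinarith [Nat.mul_le_mul_right (18 * B + 6) hB']

theorem run_times {c : StackProgram Reg} {τ : ℕ}
    (g : (Option (Fin I.numStates) → Bool) → Option (Fin I.numStates) → Bool)
    (hc : ∀ Y a a', Run c (I.mem Y u a a' b b') (I.mem (g Y) u a a' b b') τ)
    (Y : Option (Fin I.numStates) → Bool) :
    Run (times .n₁ .n₁' c) (I.mem Y u (List.replicate (I.numStates + 1) true) [] b b')
      (I.mem (g^[I.numStates + 1] Y) u (List.replicate (I.numStates + 1) true) [] b b')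
      ((I.numStates + 1) * (τ + 6) + 2) := by
  have h := Run.times (k := .n₁) (k' := .n₁') (by decide) (c := c) τ
    (List.replicate (I.numStates + 1) true)
    (fun i => I.mem (g^[i] Y) u [] [] b b') fun i _ x x' => by
      rw [iterate_succ_apply']
      exact hc _ x x'
  rw [List.length_replicate] at h
  exact h

theorem run_save (Y : Option (Fin I.numStates) → Bool) :
    Run save (I.mem Y [] a a' b b') (I.mem (fun _ => true) (I.states.map Y).reverse a a' b b')
      (7 * (I.numStates + 1) + 2) := by
  have hloop : ∀ (l u y' : List Bool) (s : Mem), Run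
      (forEach .y fun b => .seq (.push .u b) (.push .y' true))
      { s with y := l, u := u, y' := y' }
      { s with y := [], u := l.reverse ++ u, y' := (l.map fun _ => true).reverse ++ y' }
      (4 * l.length + 1) := by
    intro l
    induction l with
    | nil => exact fun _ _ _ => Run.forEach_nil rfl
    | cons x l ih =>
      intro u y' s
      have h := ih (x :: u) (true :: y') s
      refine (Run.forEach_cons (b := x) (l := l) rfl (Run.push_then (Run.push _ _ _)) ?_).mono
        (t := (1 + 1) + (4 * l.length + 1) + 2) (by simp; omega)
      simpa [Mem.set, Mem.get] using h
  have h1 := hloop (I.states.map Y) [] [] (I.mem Y [] a a' b b')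
  have h2 := Run.move (a := .y') (b := .y) (by decide) { I.mem Y [] a a' b b' with
    y := []
    u := (I.states.map Y).reverse ++ []
    y' := ((I.states.map Y).map fun _ => true).reverse ++ [] } _ rfl
  refine Run.mono (t := (4 * (I.states.map Y).length + 1) +
    (3 * (((I.states.map Y).map fun _ => true).reverse ++ []).length + 1)) (Run.seq h1 ?_) ?_
  · simpa [Mem.set, Mem.get, mem, comp_def] using h2
  · simp [length_states]; omega

/-- The set computed by the decision procedure. -/
def badStates : Option (Fin I.numStates) → Bool :=
  let ef : (Option (Fin I.numStates) → Bool) → Option (Fin I.numStates) → Bool :=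
    (fun Y v => Y v || I.ex Y v)^[I.numStates + 1]
  let nonuniversal := ef ((fun Y v => I.ex Y v && !I.acc v)^[I.numStates + 1] fun _ => true)
  let nonempty := (fun Y => ef fun v => I.ex Y v && I.acc v)^[I.numStates + 1] fun _ => true
  let good := ef fun v => !(nonempty v && nonuniversal v)
  ef fun v => !good v

theorem run_decideSets (hB : I.numStates + 1 + (tableBits I.rows).length ≤ B) :
    Run decideSets
      (I.mem (fun _ => true) [] (List.replicate (I.numStates + 1) true) []
        (List.replicate (I.numStates + 1) true) [])
      (I.mem I.badStates [] (List.replicate (I.numStates + 1) true) []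
        (List.replicate (I.numStates + 1) true) []) (250 * B ^ 3) := by
  have h1 := I.run_times [] (List.replicate (I.numStates + 1) true) []
    (fun Y v => I.ex Y v && !I.acc v)
    (fun Y a a' => I.run_step [] a a' _ _ hB (fun _ w f => w && !f) Y) fun _ => true
  set U := (fun Y v => Y v || I.ex Y v)^[I.numStates + 1]
    ((fun Y v => I.ex Y v && !I.acc v)^[I.numStates + 1] fun _ => true) with hU
  have h2 := I.run_times (I.states.map U).reverse (List.replicate (I.numStates + 1) true) []
    _ (fun Y a a' => (I.run_step _ a a' _ _ hB (fun _ w f => w && f) Y).seq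
      (I.run_closure _ a a' hB _)) fun _ => true
  set E := (fun Y => (fun Y v => Y v || I.ex Y v)^[I.numStates + 1]
    fun v => I.ex Y v && I.acc v)^[I.numStates + 1] fun _ => true with hE
  have h3 := Run.move (a := .u) (b := .w) (by decide)
    (I.mem E (I.states.map U).reverse (List.replicate (I.numStates + 1) true) []
      (List.replicate (I.numStates + 1) true) []) _ rfl
  have h4 : Run (zip fun y w _ => !(y && w)) _
      (I.mem (fun v => !(E v && U v)) [] (List.replicate (I.numStates + 1) true) []
        (List.replicate (I.numStates + 1) true) []) _ :=
    Run.zip (fun y w _ => !(y && w)) I.states E U I.acc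
      (I.mem E [] (List.replicate (I.numStates + 1) true) []
        (List.replicate (I.numStates + 1) true) [])
  simp only [Mem.set, Mem.get, mem, List.reverse_reverse, List.append_nil] at h3
  have h5 := (I.run_closure [] _ _ hB fun v => !(E v && U v)).seq
    ((I.run_step [] _ _ _ _ hB (fun y _ _ => !y) _).seq
    (I.run_closure [] (List.replicate (I.numStates + 1) true) [] hB _))
  refine Run.mono (h1.seq ((I.run_closure _ _ _ hB _).seq ((I.run_save _ _ _ _ _).seq (h2.seq
    (h3.seq (h4.seq h5)))))) ?_
  simp only [List.length_reverse, List.length_map, length_states]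
  have hB1 : I.numStates + 1 ≤ B := by omega
  have hB2 : 1 ≤ B := by omega
  have hB3 : B ≤ B ^ 3 := Nat.le_self_pow (by decide) B
  have hB4 : B ^ 2 ≤ B ^ 3 := Nat.pow_le_pow_right hB2 (by decide)
  have e1 := Nat.mul_le_mul_right (18 * B + 6) hB1
  have e2 := Nat.mul_le_mul_right (18 * B + 26 * B ^ 2 + 6) hB1
  have e3 : B * (18 * B + 6) = 18 * B ^ 2 + 6 * B := by ring
  have e4 : B * (18 * B + 26 * B ^ 2 + 6) = 18 * B ^ 2 + 26 * B ^ 3 + 6 * B := by ring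
  omega

end Instance

/-! ### Reading the input and giving the answer -/

namespace Run

variable {s s' s'' : Mem} {T : ℕ}

theorem parseEntry (k : ℕ) (s : Mem) (l t' : List Bool) :
    Run parseEntry { s with inp := unary k ++ l, t' := t' }
      { s with inp := l, t' := (entryBits k).reverse ++ t' } (4 * k + 5) := by
  have h1 := Run.forBlock (k := .inp) (c := .seq (.push .t' true) (.push .t' true)) 2
    (fun i => { s with t' := List.replicate (2 * i) true ++ t' }) l k fun i _ l' =>
      push_then (push _ _ _)
  have e : (entryBits k).reverse ++ t' =
      false :: true :: (List.replicate (2 * k) true ++ t') := by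
    simp only [entryBits, List.reverse_append, List.reverse_replicate]
    rfl
  rw [e]
  exact (seq h1 (push_then (push _ _ _))).mono (by omega)

theorem parseRow (b : Bool) (es : List ℕ) {K : ℕ} (hK : ∀ k ∈ es, k ≤ K) (s : Mem)
    (l t' f' y : List Bool) :
    Run (parseRow b)
      { s with
        inp := es.flatMap unary ++ l
        t' := t'
        f' := f'
        y := y
        m := List.replicate es.length true
        m' := [] }
      { s with
        inp := l
        t' := (rowBits es).reverse ++ t'
        f' := b :: f'
        y := true :: y
        m := List.replicate es.length true
        m' := [] } (es.length * (4 * K + 11) + 5) := by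
  have h := Run.times (k := .m) (k' := .m') (by decide) (c := Monitorability.parseEntry) (4 * K + 5)
    (List.replicate es.length true) (fun i => { s with
      inp := (es.drop i).flatMap unary ++ l
      t' := ((es.take i).flatMap entryBits).reverse ++ t'
      f' := b :: f'
      y := true :: y }) fun i hi x x' => by
    rw [List.length_replicate] at hi
    have h1 := parseEntry es[i] { s with f' := b :: f', y := true :: y, m := x, m' := x' }
      ((es.drop (i + 1)).flatMap unary ++ l) (((es.take i).flatMap entryBits).reverse ++ t')
    have := hK es[i] (List.getElem_mem hi)
    refine Run.mono ?_ (t := 4 * es[i] + 5) (by omega)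
    have e : (es.drop i).flatMap unary ++ l =
        unary es[i] ++ ((es.drop (i + 1)).flatMap unary ++ l) := by
      rw [List.drop_eq_getElem_cons hi, List.flatMap_cons, List.append_assoc]
    have e' : ((es.take (i + 1)).flatMap entryBits).reverse ++ t' =
        (entryBits es[i]).reverse ++ (((es.take i).flatMap entryBits).reverse ++ t') := by
      rw [List.take_succ_eq_append_getElem hi, List.flatMap_append, List.flatMap_singleton,
        List.reverse_append, List.append_assoc]
    dsimp only [Mem.set]
    rw [e, e']
    exact h1
  rw [List.length_replicate] at h
  refine push_then (push_then (T := es.length * (4 * K + 11) + 3) (Run.mono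
    (t := (es.length * (4 * K + 11) + 2) + 1) (seq (s' := { s with
      inp := l
      t' := (es.flatMap entryBits).reverse ++ t'
      f' := b :: f'
      y := true :: y
      m := List.replicate es.length true
      m' := [] }) ?_ ?_) (by omega)))
  · simpa [Mem.set, Mem.get] using h
  · rw [show (rowBits es).reverse ++ t' = false :: ((es.flatMap entryBits).reverse ++ t') by
      simp [rowBits]]
    exact push _ _ _

theorem parseRows {V : Type} (b : V → Bool) (es : V → List ℕ) {M K : ℕ}
    (hM : ∀ v, (es v).length = M) (hK : ∀ v, ∀ k ∈ es v, k ≤ K) (qs : List V) (s : Mem)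
    (t' f' y : List Bool) :
    Run (forEach .inp Monitorability.parseRow)
      { s with
        inp := qs.flatMap fun v => b v :: (es v).flatMap unary
        t' := t'
        f' := f'
        y := y
        m := List.replicate M true
        m' := [] }
      { s with
        inp := []
        t' := (tableBits (qs.map es)).reverse ++ t'
        f' := (qs.map b).reverse ++ f'
        y := List.replicate qs.length true ++ y
        m := List.replicate M true
        m' := [] } (qs.length * (M * (4 * K + 11) + 7) + 1) := by
  induction qs generalizing t' f' y with
  | nil => exact (forEach_nil rfl).mono (by omega)
  | cons v qs ih =>
    have h1 := parseRow (b v) (es v) (hK v) s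
      (qs.flatMap fun v => b v :: (es v).flatMap unary) t' f' y
    rw [hM] at h1
    have h2 := ih ((rowBits (es v)).reverse ++ t') (b v :: f') (true :: y)
    refine (forEach_cons (b := b v) rfl h1 (t' := qs.length * (M * (4 * K + 11) + 7) + 1) ?_).mono
      (by simp only [List.length_cons]; ring_nf; omega)
    have e : List.replicate (v :: qs).length true ++ y =
        List.replicate qs.length true ++ true :: y := by
      rw [List.length_cons, List.replicate_succ', List.append_assoc]
      rfl
    rw [e]
    simpa [tableBits] using h2

end Run

namespace Instance

variable (I : Instance) {B : ℕ}

theorem encode_eq : I.encode = unary I.numStates ++ (unary I.numSymbols ++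
    (unary I.aut.start.val ++ (List.finRange I.numStates).flatMap fun q =>
      I.acc (some q) :: ((I.succs (some q)).map I.index).flatMap unary)) := by
  have e : ∀ o : Option (Fin I.numStates), encodeTarget o = unary (I.index o) := by
    rintro (- | q) <;> rfl
  simp only [encode, acc, succs, List.map_map, List.flatMap_map, e, List.append_assoc, comp_apply]

theorem run_parse (hB : I.numStates + I.numSymbols + 1 + (tableBits I.rows).length ≤ B) :
    Run parse { inp := I.encode } (I.mem (fun _ => true) [] (List.replicate (I.numStates + 1) true)
      [] (List.replicate (I.numStates + 1) true) []) (60 * B ^ 3) := by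
  rw [encode_eq]
  set rest := (List.finRange I.numStates).flatMap fun q =>
      I.acc (some q) :: ((I.succs (some q)).map I.index).flatMap unary with hrest
  have h1 := Run.forBlock (k := .inp) (c := .seq (.push .n₁ true) (.push .n₂ true)) 2
    (fun i => { n₁ := List.replicate i true, n₂ := List.replicate i true })
    (unary I.numSymbols ++ (unary I.aut.start.val ++ rest)) I.numStates fun i _ l' =>
      Run.push_then (Run.push _ _ _)
  have h2 := Run.forBlock (k := .inp) (c := .push .m true) 1
    (fun i => {
      n₁ := List.replicate (I.numStates + 1) true
      n₂ := List.replicate (I.numStates + 1) true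
      m := List.replicate i true })
    (unary I.aut.start.val ++ rest) I.numSymbols fun i _ l' => Run.push _ _ _
  have h3 := Run.forBlock (k := .inp) (c := .push .q true) 1
    (fun i => {
      n₁ := List.replicate (I.numStates + 1) true
      n₂ := List.replicate (I.numStates + 1) true
      m := List.replicate I.numSymbols true
      q := List.replicate i true })
    rest I.aut.start.val fun i _ l' => Run.push _ _ _
  have h4 := Run.parseRows (fun q => I.acc (some q)) (fun q => (I.succs (some q)).map I.index)
    (M := I.numSymbols) (K := I.numStates) (by simp [succs])
    (by
      intro q k hk
      obtain ⟨p, _, rfl⟩ := List.mem_map.1 hk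
      cases p with
      | none => exact Nat.zero_le _
      | some p => exact p.isLt) (List.finRange I.numStates)
    { n₁ := List.replicate (I.numStates + 1) true
      n₂ := List.replicate (I.numStates + 1) true
      q := List.replicate (I.aut.start.val + 1) true }
    [false, false, true] [false] [true]
  set m₁ := I.mem (fun _ => true) [] (List.replicate (I.numStates + 1) true) []
    (List.replicate (I.numStates + 1) true) [] with hm
  have h5 : Run (move .t' .t)
      { m₁ with
        t := []
        t' := (tableBits I.rows).reverse
        f := []
        f' := (I.states.map I.acc).reverse }
      { m₁ with f := [], f' := (I.states.map I.acc).reverse }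
      (3 * (tableBits I.rows).reverse.length + 1) := by
    convert Run.move (a := .t') (b := .t) (by decide) _ _ rfl using 1
    · simp [Mem.set, Mem.get, m₁, mem]
    · rfl
  have h6 : Run (move .f' .f) { m₁ with f := [], f' := (I.states.map I.acc).reverse } m₁
      (3 * (I.states.map I.acc).reverse.length + 1) := by
    convert Run.move (a := .f') (b := .f) (by decide) _ _ rfl using 1
    · simp [Mem.set, Mem.get, m₁, mem]
    · rfl
  have e1 : (tableBits ((List.finRange I.numStates).map fun q =>
      (I.succs (some q)).map I.index)).reverse ++ [false, false, true] =
      (tableBits I.rows).reverse := by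
    simp [rows, states, tableBits, rowBits, entryBits, succs, index, comp_def]
  have e2 : ((List.finRange I.numStates).map fun q => I.acc (some q)).reverse ++ [false] =
      (I.states.map I.acc).reverse := by
    simp [states, acc, comp_def]
  have e3 : List.replicate (List.finRange I.numStates).length true ++ [true] =
      I.states.map fun _ => true := by
    rw [List.map_const', length_states, List.length_finRange, List.replicate_succ']
  rw [e1, e2, e3] at h4
  refine Run.mono (h1.seq (Run.push_then (Run.push_then (h2.seq (h3.seq (Run.push_then
    (Run.push_then
      (Run.push_then (Run.push_then (Run.push_then (Run.push_then (h4.seq (h5.seq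
      h6))))))))))))) ?_
  have := I.aut.start.isLt
  have hB1 : I.numStates ≤ B := by omega
  have hB2 : I.numSymbols ≤ B := by omega
  have hB3 : 1 ≤ B := by omega
  have hB4 : B ≤ B ^ 3 := Nat.le_self_pow (by decide) B
  have hB5 : B ^ 2 ≤ B ^ 3 := Nat.pow_le_pow_right hB3 (by decide)
  have e4 : I.numStates * (I.numSymbols * (4 * I.numStates + 11) + 7) ≤
      B * (B * (4 * B + 11) + 7) := by gcongr
  have e5 : B * (B * (4 * B + 11) + 7) = 4 * B ^ 3 + 11 * B ^ 2 + 7 * B := by ring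
  simp only [List.length_reverse, List.length_map, length_states, List.length_finRange]
  omega

theorem run_answer (hB : I.numStates + I.numSymbols + 1 + (tableBits I.rows).length ≤ B)
    (Y : Option (Fin I.numStates) → Bool) :
    Run answer (I.mem Y [] (List.replicate (I.numStates + 1) true) []
      (List.replicate (I.numStates + 1) true) []) { out := [!Y (some I.aut.start)] }
      (20 * B) := by
  have hloop : ∀ (l y : List Bool) (s : Mem), Run (forEach .q fun _ => .pop .y fun _ => .skip)
      { s with q := l, y := y } { s with q := [], y := y.drop l.length } (4 * l.length + 1) := by
    intro l
    induction l with
    | nil => exact fun _ _ => Run.forEach_nil rfl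
    | cons b l ih =>
      intro y s
      have h := ih y.tail s
      refine (Run.forEach_cons (b := b) (l := l) rfl (Run.pop (Run.skip _))
        (t' := 4 * l.length + 1) ?_).mono (by simp; omega)
      simpa [Mem.set, Mem.get] using h
  have h1 := hloop (List.replicate (I.aut.start.val + 1) true) (I.states.map Y)
    (I.mem Y [] (List.replicate (I.numStates + 1) true) []
      (List.replicate (I.numStates + 1) true) [])
  -- Dropping the sink and all states before the initial one brings the bit of the initial state to
  -- the top.
  have e : ((I.states.map Y).drop (I.aut.start.val + 1)).head? = some (Y (some I.aut.start)) := by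
    rw [List.head?_drop]
    exact I.getElem?_states Y (some I.aut.start)
  rw [List.length_replicate] at h1
  set y := (I.states.map Y).drop (I.aut.start.val + 1) with hy
  have hl : y.length ≤ I.numStates + 1 := by
    simp only [y, List.length_drop, List.length_map, length_states]
    omega
  set m₁ : Mem :=
    { out := [!Y (some I.aut.start)]
      n₁ := List.replicate (I.numStates + 1) true
      n₂ := List.replicate (I.numStates + 1) true
      m := List.replicate I.numSymbols true
      t := tableBits I.rows
      f := I.states.map I.acc
      y := y.tail } with hm
  have h2 : Run (.pop .y fun o => .push .out (!(o.getD false)))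
      { I.mem Y [] (List.replicate (I.numStates + 1) true) []
        (List.replicate (I.numStates + 1) true) [] with q := [], y := y } m₁ (1 + 1) := by
    refine Run.pop ?_
    dsimp only [Mem.set, Mem.get]
    rw [e]
    exact Run.push _ _ _
  have h3 := ((Run.clear .n₁ m₁).seq ((Run.clear .n₂ _).seq ((Run.clear .m _).seq
    ((Run.clear .t _).seq ((Run.clear .f _).seq (Run.clear .y _))))))
  refine Run.mono (h1.seq (h2.seq h3)) ?_
  have := I.aut.start.isLt
  simp only [Mem.set, Mem.get, m₁, List.length_replicate, List.length_tail, List.length_map,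
    length_states]
  omega

/-- An entry `k` takes `2 * k + 2` bits for scanning against `k + 1` in the input, and the end mark
of a row is paid for by the acceptance bit. -/
theorem length_tableBits_le {V : Type} (b : V → Bool) (es : V → List ℕ) (qs : List V) :
    (tableBits (qs.map es)).length ≤
      2 * (qs.flatMap fun v => b v :: (es v).flatMap unary).length := by
  have h : ∀ l : List ℕ, (l.flatMap entryBits).length = 2 * (l.flatMap unary).length := by
    intro l
    induction l with
    | nil => rfl
    | cons k l ih => simp [ih, entryBits, unary]; omega
  induction qs with
  | nil => simp [tableBits]
  | cons v qs ih =>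
    have := h (es v)
    have e : (tableBits ((v :: qs).map es)).length =
        ((es v).flatMap entryBits).length + 1 + (tableBits (qs.map es)).length := by
      simp [tableBits, rowBits]
      omega
    rw [e, List.flatMap_cons, List.length_append, List.length_cons]
    omega

theorem size_le : I.numStates + I.numSymbols + 1 + (tableBits I.rows).length ≤
    2 * I.encode.length := by
  have h := length_tableBits_le (fun q => I.acc (some q)) (fun q => (I.succs (some q)).map I.index)
    (List.finRange I.numStates)
  have e : (tableBits I.rows).length = 3 + (tableBits ((List.finRange I.numStates).map
      fun q => (I.succs (some q)).map I.index)).length := by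
    simp [rows, states, tableBits, rowBits, entryBits, succs, index, comp_def]
    omega
  rw [encode_eq, e]
  simp only [List.length_append, unary, List.length_replicate, List.length_singleton]
  omega

/-- The size bound is `B = 2 * I.encode.length`; the three phases take at most `(60 + 250 + 20) * B
^ 3` steps, and `330 * 8 = 2640`. -/
theorem run_decideMonitorable : Run decideMonitorable { inp := I.encode }
    { out := [!I.badStates (some I.aut.start)] } (2640 * I.encode.length ^ 3) := by
  have hB := I.size_le
  have hB' : I.numStates + 1 + (tableBits I.rows).length ≤ 2 * I.encode.length := by omega
  refine ((I.run_parse hB).seq ((I.run_decideSets hB').seq (I.run_answer hB _))).mono ?_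
  have h : I.encode.length ≤ I.encode.length ^ 3 := Nat.le_self_pow (by decide) _
  have e : (2 * I.encode.length) ^ 3 = 8 * I.encode.length ^ 3 := by ring
  rw [e]
  omega

end Instance

theorem decidableInPolyTime_of_badStates (P : Instance → Prop)
    (h : ∀ I : Instance, I.badStates (some I.aut.start) = false ↔ P I) :
    DecidableInPolyTime Instance.encode P := by
  refine ⟨fun I => !I.badStates (some I.aut.start), fun I => by simpa using h I, ?_⟩
  refine computableInPolyTime _ _ decideMonitorable .inp .out (2640 * Polynomial.X ^ 3) fun I => ?_
  obtain ⟨t, ht, hrun⟩ := I.run_decideMonitorable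
  refine ⟨t, by simpa using ht, ?_⟩
  convert hrun using 1 <;> funext k <;> cases k <;> rfl


/-! ### Fixed point iterations on finite graphs -/

/-- If the orbit stalls within `N` rounds, it stays put and the `N`-th iterate is fixed. Otherwise
`μ` increases `N + 1` times and exceeds its bound. -/
theorem iterate_isFixedPt {α : Type*} (f : α → α) (x : α) (μ : α → ℕ) (N : ℕ) (hN : ∀ y, μ y ≤ N)
    (hμ : ∀ k, f^[k + 1] x ≠ f^[k] x → μ (f^[k] x) < μ (f^[k + 1] x)) :
    IsFixedPt f (f^[N] x) := by
  by_contra hf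
  have hne : ∀ k ≤ N, f^[k + 1] x ≠ f^[k] x := by
    intro k hk he
    have hfix : IsFixedPt f (f^[k] x) := by rwa [iterate_succ_apply'] at he
    obtain ⟨j, rfl⟩ := Nat.exists_eq_add_of_le hk
    rw [add_comm, iterate_add_apply, hfix.iterate j] at hf
    exact hf hfix
  have hle : ∀ k ≤ N + 1, k ≤ μ (f^[k] x) := by
    intro k
    induction k with
    | zero => exact fun _ => Nat.zero_le _
    | succ k ih =>
      exact fun hk => (ih (by omega)).trans_lt (hμ k (hne k (by omega)))
  exact absurd ((hle (N + 1) le_rfl).trans (hN _)) (by omega)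

section Graph

variable {V : Type*} {R : V → V → Prop} {ex : (V → Bool) → V → Bool}

/-- Coinduction principle: a set contained in its image survives every round of the descending
iteration from the full set. -/
theorem le_iterate_of_le {g : (V → Bool) → V → Bool} (hg : Monotone g) {P : V → Bool}
    (hP : P ≤ g P) (k : ℕ) : P ≤ g^[k] fun _ => true := by
  induction k with
  | zero => exact fun v => Bool.le_true _
  | succ k ih => rw [iterate_succ_apply']; exact hP.trans (hg ih)

theorem monotone_ex (hex : ∀ Y v, ex Y v = true ↔ ∃ p, R v p ∧ Y p = true) : Monotone ex := by
  intro Y Z h v hv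
  obtain ⟨p, hp, hY⟩ := (hex Y v).1 hv
  exact (hex Z v).2 ⟨p, hp, h p hY⟩

theorem closure_monotone (hex : ∀ Y v, ex Y v = true ↔ ∃ p, R v p ∧ Y p = true) :
    Monotone fun (Y : V → Bool) v => Y v || ex Y v := by
  intro Y Z h v hv
  simp only [Bool.or_eq_true] at hv ⊢
  exact hv.imp (h v) (monotone_ex hex h v)

variable [Fintype V] {N : ℕ}

theorem isFixedPt_of_monotone (hN : Fintype.card V ≤ N) {g : (V → Bool) → V → Bool}
    (hg : Monotone g) {Y : V → Bool} (hY : Y ≤ g Y) : IsFixedPt g (g^[N] Y) := by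
  refine iterate_isFixedPt g Y (fun Z => (Finset.univ.filter fun v => Z v = true).card) N
    (fun Z => (Finset.card_le_univ _).trans hN) fun k hk => Finset.card_lt_card ?_
  have hle : g^[k] Y ≤ g^[k + 1] Y := hg.monotone_iterate_of_le_map hY (Nat.le_succ k)
  rw [Finset.ssubset_iff_subset_ne]
  refine ⟨fun v hv => ?_, fun he => hk (funext fun v => ?_)⟩
  · simp only [Finset.mem_filter, Finset.mem_univ, true_and] at hv ⊢
    exact hle v hv
  · have := congrArg (v ∈ ·) he
    simp only [Finset.mem_filter, Finset.mem_univ, true_and, eq_iff_iff] at this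
    exact Bool.eq_iff_iff.2 this.symm

theorem isFixedPt_of_antitone (hN : Fintype.card V ≤ N) {g : (V → Bool) → V → Bool}
    (hg : Monotone g) : IsFixedPt g (g^[N] fun _ => true) := by
  refine iterate_isFixedPt g _ (fun Z => (Finset.univ.filter fun v => Z v = false).card) N
    (fun Z => (Finset.card_le_univ _).trans hN) fun k hk => Finset.card_lt_card ?_
  have hle : g^[k + 1] (fun _ => true) ≤ g^[k] (fun _ => true) :=
    hg.antitone_iterate_of_map_le (fun v => Bool.le_true _) (Nat.le_succ k)
  rw [Finset.ssubset_iff_subset_ne]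
  refine ⟨fun v hv => ?_, fun he => hk (funext fun v => ?_)⟩
  · simp only [Finset.mem_filter, Finset.mem_univ, true_and] at hv ⊢
    exact Bool.eq_false_of_le_false ((hle v).trans hv.le)
  · have := congrArg (v ∈ ·) he
    simp only [Finset.mem_filter, Finset.mem_univ, true_and, eq_iff_iff] at this
    exact (Bool.eq_iff_iff.2 (by simpa using not_congr this.symm))

/-- Iterating the one-step closure yields the states from which a set is reachable. -/
theorem closure_eq_true_iff (hN : Fintype.card V ≤ N)
    (hex : ∀ Y v, ex Y v = true ↔ ∃ p, R v p ∧ Y p = true) (Y : V → Bool) (v : V) :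
    (fun (Y : V → Bool) v => Y v || ex Y v)^[N] Y v = true ↔
      ∃ p, ReflTransGen R v p ∧ Y p = true := by
  set g : (V → Bool) → V → Bool := fun Y v => Y v || ex Y v with hg
  constructor
  -- Soundness holds for any number of rounds; only the converse needs stabilisation.
  · generalize N = k
    induction k generalizing v with
    | zero => exact fun h => ⟨v, .refl, h⟩
    | succ k ih =>
      intro h
      rw [iterate_succ_apply'] at h
      rcases Bool.or_eq_true_iff.1 h with h | h
      · exact ih v h
      · obtain ⟨p, hp, h⟩ := (hex _ v).1 h
        obtain ⟨p', hp', h⟩ := ih p h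
        exact ⟨p', .head hp hp', h⟩
  · rintro ⟨p, hp, h⟩
    have hle : Y ≤ g Y := fun v hv => by simp [hg, show Y v = true from hv]
    have hfix := isFixedPt_of_monotone hN (closure_monotone hex) hle
    induction hp using ReflTransGen.head_induction_on with
    | refl =>
      exact (closure_monotone hex).monotone_iterate_of_le_map hle (Nat.zero_le N) p h
    | @head a b hab _ ih =>
      rw [← hfix]
      exact Bool.or_eq_true_iff.2 (Or.inr ((hex _ a).2 ⟨b, hab, ih⟩))

/-- The states from which there is an infinite path that avoids a set. -/
theorem iterate_eq_true_iff_exists_path_avoiding (hN : Fintype.card V ≤ N)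
    (hex : ∀ Y v, ex Y v = true ↔ ∃ p, R v p ∧ Y p = true) (acc : V → Bool) (v : V) :
    (fun (Y : V → Bool) v => ex Y v && !acc v)^[N] (fun _ => true) v = true ↔
      ∃ ρ : ℕ → V, ρ 0 = v ∧ (∀ i, R (ρ i) (ρ (i + 1))) ∧ ∀ i, acc (ρ i) = false := by
  classical
  set g : (V → Bool) → V → Bool := fun Y v => ex Y v && !acc v with hg
  have hmono : Monotone g := by
    intro Y Z h v hv
    simp only [hg, Bool.and_eq_true] at hv ⊢
    exact ⟨monotone_ex hex h v hv.1, hv.2⟩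
  constructor
  · intro h
    have hfix := isFixedPt_of_antitone hN hmono
    -- A state of the fixed point is non-accepting and has a successor in the fixed point, so a path
    -- can be continued forever.
    have hnext : ∀ v, g^[N] (fun _ => true) v = true →
        acc v = false ∧ ∃ p, R v p ∧ g^[N] (fun _ => true) p = true := by
      intro v hv
      rw [← hfix] at hv
      obtain ⟨h1, h2⟩ := Bool.and_eq_true_iff.1 hv
      exact ⟨by simpa using h2, (hex _ v).1 h1⟩
    have : Nonempty V := ⟨v⟩
    choose! next hR hZ using fun v hv => (hnext v hv).2
    have hρ : ∀ i, g^[N] (fun _ => true) (next^[i] v) = true := by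
      intro i
      induction i with
      | zero => exact h
      | succ i ih => rw [iterate_succ_apply']; exact hZ _ ih
    refine ⟨fun i => next^[i] v, rfl, fun i => ?_, fun i => (hnext _ (hρ i)).1⟩
    dsimp only
    rw [iterate_succ_apply']
    exact hR _ (hρ i)
  · intro h
    let P : V → Bool := fun v => decide (∃ ρ : ℕ → V, ρ 0 = v ∧ (∀ i, R (ρ i) (ρ (i + 1))) ∧
      ∀ i, acc (ρ i) = false)
    refine le_iterate_of_le hmono (P := P) ?_ N v (decide_eq_true h)
    intro v hv
    obtain ⟨ρ, rfl, hR, hacc⟩ := of_decide_eq_true hv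
    refine Bool.and_eq_true_iff.2 ⟨(hex _ _).2 ⟨ρ 1, hR 0, decide_eq_true ⟨fun i => ρ (i + 1), rfl,
      fun i => hR _, fun i => hacc _⟩⟩, by simp [hacc 0]⟩

/-- The states from which there is an infinite path that visits a set infinitely often. -/
theorem iterate_eq_true_iff_exists_path_visiting (hN : Fintype.card V ≤ N)
    (hex : ∀ Y v, ex Y v = true ↔ ∃ p, R v p ∧ Y p = true) (acc : V → Bool) (v : V) :
    (fun Y : V → Bool => (fun (Y : V → Bool) v => Y v || ex Y v)^[N] fun v => ex Y v && acc v)^[N]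
        (fun _ => true) v = true ↔
      ∃ ρ : ℕ → V, ρ 0 = v ∧ (∀ i, R (ρ i) (ρ (i + 1))) ∧ ∀ i, ∃ j ≥ i, acc (ρ j) = true := by
  classical
  set c : (V → Bool) → V → Bool := fun Y v => Y v || ex Y v with hc
  set g : (V → Bool) → V → Bool := fun Y => c^[N] fun v => ex Y v && acc v with hg
  have hcm : Monotone c := closure_monotone hex
  have hmono : Monotone g := by
    intro Y Z h
    refine hcm.iterate N fun v hv => ?_
    simp only [Bool.and_eq_true] at hv ⊢
    exact ⟨monotone_ex hex h v hv.1, hv.2⟩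
  constructor
  · intro h
    have hfix : g (g^[N] fun _ => true) = g^[N] fun _ => true := isFixedPt_of_antitone hN hmono
    set Z := g^[N] fun _ => true with hZdef
    set target : V → Bool := fun v => ex Z v && acc v with htarget
    have hrank : ∀ v, Z v = true → ∃ k, c^[k] target v = true := by
      intro v hv
      rw [← hfix] at hv
      exact ⟨N, hv⟩
    -- The distance to an accepting state with a successor in `Z`. A path is built along which the
    -- rank drops at each non-accepting state, so that acceptance recurs.
    let rank : V → ℕ := fun v => sInf {k | c^[k] target v = true}
    -- Any iterate of the closure only adds states that reach `target`, and these already lie in `g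
    -- Z = Z`.
    have hcZ : ∀ k v, c^[k] target v = true → Z v = true := by
      intro k v hv
      rw [← hfix]
      refine (closure_eq_true_iff hN hex _ v).2 ?_
      exact (closure_eq_true_iff (N := N + k) (by omega) hex target v).1
        (hcm.monotone_iterate_of_le_map (fun v hv => by simp [hc, show target v = true from hv])
          (Nat.le_add_left k N) v hv)
    have hnext : ∀ v, Z v = true → ∃ p, R v p ∧ Z p = true ∧ (acc v = true ∨ rank p < rank v) := by
      intro v hv
      have hk : c^[rank v] target v = true := Nat.sInf_mem (hrank v hv)
      rcases hr : rank v with - | k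
      · rw [hr] at hk
        obtain ⟨h1, h2⟩ := Bool.and_eq_true_iff.1 (show (ex Z v && acc v) = true from hk)
        obtain ⟨p, hp, hZ⟩ := (hex _ v).1 h1
        exact ⟨p, hp, hZ, Or.inl h2⟩
      · rw [hr, iterate_succ_apply'] at hk
        rcases Bool.or_eq_true_iff.1 hk with hk | hk
        · have : rank v ≤ k := Nat.sInf_le hk
          omega
        · obtain ⟨p, hp, hk⟩ := (hex _ v).1 hk
          have : rank p ≤ k := Nat.sInf_le hk
          exact ⟨p, hp, hcZ k p hk, Or.inr (by omega)⟩
    have : Nonempty V := ⟨v⟩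
    choose! next hR hZ hacc using hnext
    have hρ : ∀ i, Z (next^[i] v) = true := by
      intro i
      induction i with
      | zero => exact h
      | succ i ih => rw [iterate_succ_apply']; exact hZ _ ih
    refine ⟨fun i => next^[i] v, rfl, fun i => ?_, fun i => ?_⟩
    · dsimp only
      rw [iterate_succ_apply']
      exact hR _ (hρ i)
    · induction hk : rank (next^[i] v) using Nat.strong_induction_on generalizing i with
      | _ k ih =>
        rcases hacc _ (hρ i) with ha | hlt
        · exact ⟨i, le_rfl, ha⟩
        · rw [← iterate_succ_apply' next i v, hk] at hlt
          obtain ⟨j, hj, ha⟩ := ih _ hlt (i + 1) rfl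
          exact ⟨j, by omega, ha⟩
  · intro h
    let P : V → Bool := fun v => decide (∃ ρ : ℕ → V, ρ 0 = v ∧ (∀ i, R (ρ i) (ρ (i + 1))) ∧
      ∀ i, ∃ j ≥ i, acc (ρ j) = true)
    refine le_iterate_of_le hmono (P := P) ?_ N v (decide_eq_true h)
    intro v hv
    obtain ⟨ρ, rfl, hR, hacc⟩ := of_decide_eq_true hv
    obtain ⟨j, -, hj⟩ := hacc 0
    have hreach : ∀ i, ReflTransGen R (ρ 0) (ρ i) := by
      intro i
      induction i with
      | zero => exact .refl
      | succ i ih => exact ih.tail (hR i)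
    -- The path reaches its first chosen accepting state `ρ j`, and the tail from `ρ (j + 1)` is
    -- again such a path.
    refine (closure_eq_true_iff hN hex _ _).2 ⟨ρ j, hreach j, Bool.and_eq_true_iff.2
      ⟨(hex _ _).2 ⟨ρ (j + 1), hR j, decide_eq_true ⟨fun i => ρ (j + 1 + i), rfl, fun i => hR _,
        fun i => ?_⟩⟩, hj⟩⟩
    obtain ⟨k, hk, ha⟩ := hacc (j + 1 + i)
    exact ⟨k - (j + 1), by omega, by
      dsimp only
      rwa [show j + 1 + (k - (j + 1)) = k by omega]⟩

end Graph

/-! ### Words, paths and languages of deterministic automata -/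

namespace DBA

variable {Q S : Type} (A : DBA Q S)

/-- The successor relation of an automaton. -/
def Succ (p p' : Q) : Prop :=
  ∃ a : S, A.step p a = some p'

/-- By determinism every run on the longer word passes through `q'`, and shifting a run by one
position does not affect infinitely many visits. -/
theorem cons_mem_language_iff {q q' : Q} {a : S} (h : A.step q a = some q') (w : Stream' S) :
    Stream'.cons a w ∈ (A.startingAt q).language ↔ w ∈ (A.startingAt q').language := by
  constructor
  · rintro ⟨ρ, ⟨h0, hρ⟩, hF⟩
    refine ⟨fun i => ρ (i + 1), ⟨?_, fun i => hρ (i + 1)⟩, ?_⟩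
    · have h1 := hρ 0
      rw [h0] at h1
      exact Option.some.inj (h1.symm.trans h)
    · rw [Filter.frequently_atTop] at hF ⊢
      intro i
      obtain ⟨j, hj, hF⟩ := hF (i + 1)
      obtain ⟨j, rfl⟩ := Nat.exists_eq_add_of_le hj
      exact ⟨i + j, by omega, by
        dsimp only
        rwa [show i + j + 1 = i + 1 + j by omega]⟩
  · rintro ⟨ρ, ⟨h0, hρ⟩, hF⟩
    refine ⟨fun i => Nat.casesOn i q ρ, ⟨rfl, fun i => ?_⟩, ?_⟩
    · cases i with
      | zero => exact h.trans (congrArg some h0.symm)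
      | succ i => exact hρ i
    · rw [Filter.frequently_atTop] at hF ⊢
      intro i
      obtain ⟨j, hj, hF⟩ := hF i
      exact ⟨j + 1, by omega, hF⟩

/-- `q` leads to `q'` on a finite word. -/
inductive Path : Q → List S → Q → Prop
  | nil (q : Q) : Path q [] q
  | cons {q q' q'' : Q} {a : S} {x : List S} :
      A.step q a = some q' → Path q' x q'' → Path q (a :: x) q''

variable {A}

theorem Path.append_mem_language_iff {q q' : Q} {x : List S} (h : A.Path q x q') (w : Stream' S) :
    x ++ₛ w ∈ (A.startingAt q).language ↔ w ∈ (A.startingAt q').language := by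
  induction h with
  | nil q => rfl
  | cons h _ ih => exact (A.cons_mem_language_iff h _).trans ih

theorem Path.reaches {q q' : Q} {x : List S} (h : A.Path q x q') : A.Reaches q q' := by
  induction h with
  | nil q => exact .refl
  | cons h _ ih => exact .head ⟨_, h⟩ ih

theorem Path.append {q q' q'' : Q} {x y : List S} (h : A.Path q x q') (h' : A.Path q' y q'') :
    A.Path q (x ++ y) q'' := by
  induction h with
  | nil q => exact h'
  | cons h _ ih => exact .cons h (ih h')

theorem Reaches.exists_path {q q' : Q} (h : A.Reaches q q') : ∃ x, A.Path q x q' := by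
  induction h using ReflTransGen.head_induction_on with
  | refl => exact ⟨[], .nil _⟩
  | head h _ ih =>
    obtain ⟨a, h⟩ := h
    obtain ⟨x, hx⟩ := ih
    exact ⟨a :: x, .cons h hx⟩

theorem IsComplete.exists_path (hA : A.IsComplete) (q : Q) (x : List S) : ∃ q', A.Path q x q' := by
  induction x generalizing q with
  | nil => exact ⟨q, .nil q⟩
  | cons a x ih =>
    obtain ⟨p, hp⟩ := hA q a
    obtain ⟨q', hq'⟩ := ih p
    exact ⟨q', .cons hp hq'⟩

theorem positivelyDetermined_iff {q : Q} {x : List S} (h : A.Path A.start x q) :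
    PositivelyDetermined A.language x ↔ (A.startingAt q).language = Set.univ := by
  rw [Set.eq_univ_iff_forall]
  exact forall_congr' fun w => h.append_mem_language_iff w

theorem negativelyDetermined_iff {q : Q} {x : List S} (h : A.Path A.start x q) :
    NegativelyDetermined A.language x ↔ (A.startingAt q).language = ∅ := by
  rw [Set.eq_empty_iff_forall_notMem]
  exact forall_congr' fun w => not_congr (h.append_mem_language_iff w)

/-- Words are traded for the states they lead to: completeness supplies a state for every word, and
reachability a word for every reachable state. -/
theorem IsComplete.monitorable_iff (hA : A.IsComplete) :
    Monitorable A.language ↔ ∀ q, A.Reaches A.start q → ∃ q', A.Reaches q q' ∧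
      ((A.startingAt q').language = ∅ ∨ (A.startingAt q').language = Set.univ) := by
  constructor
  · intro h q hq
    obtain ⟨x, hx⟩ := hq.exists_path
    obtain ⟨y, hy⟩ := h x
    obtain ⟨q', hq'⟩ := hA.exists_path q y
    rw [positivelyDetermined_iff (hx.append hq'), negativelyDetermined_iff (hx.append hq')] at hy
    exact ⟨q', hq'.reaches, hy.symm⟩
  · intro h x
    obtain ⟨q, hx⟩ := hA.exists_path A.start x
    obtain ⟨q', hq', hy⟩ := h q hx.reaches
    obtain ⟨y, hy'⟩ := hq'.exists_path
    refine ⟨y, ?_⟩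
    rw [positivelyDetermined_iff (hx.append hy'), negativelyDetermined_iff (hx.append hy')]
    exact hy.symm

theorem IsTrap.language_eq_empty {q : Q} (h : A.IsTrap q) : (A.startingAt q).language = ∅ := by
  rw [Set.eq_empty_iff_forall_notMem]
  rintro w ⟨ρ, ⟨h0, hρ⟩, hF⟩
  have hq : ∀ i, ρ i = q := by
    intro i
    induction i with
    | zero => exact h0
    | succ i ih =>
      have h1 : A.step (ρ i) (w.get i) = some (ρ (i + 1)) := hρ i
      rw [ih, h.2] at h1
      exact (Option.some.inj h1).symm
  obtain ⟨i, hi⟩ := hF.exists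
  rw [hq i] at hi
  exact h.1 hi

/-- An automaton accepts some word from `q` iff there is an infinite path from `q` that
visits accepting states infinitely often. -/
theorem language_nonempty_iff {q : Q} : (A.startingAt q).language ≠ ∅ ↔
    ∃ ρ : ℕ → Q, ρ 0 = q ∧ (∀ i, A.Succ (ρ i) (ρ (i + 1))) ∧ ∀ i, ∃ j ≥ i, ρ j ∈ A.accept := by
  rw [← Set.nonempty_iff_ne_empty]
  constructor
  · rintro ⟨w, ρ, ⟨h0, hρ⟩, hF⟩
    exact ⟨ρ, h0, fun i => ⟨_, hρ i⟩, Filter.frequently_atTop.1 hF⟩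
  · rintro ⟨ρ, h0, hρ, hF⟩
    choose w hw using hρ
    exact ⟨w, ρ, ⟨h0, hw⟩, Filter.frequently_atTop.2 hF⟩

/-- A complete automaton rejects some word from `q` iff a state can be reached from `q` at which an
infinite path without accepting states starts. -/
theorem IsComplete.language_ne_univ_iff (hA : A.IsComplete) {q : Q} :
    (A.startingAt q).language ≠ Set.univ ↔ ∃ p, A.Reaches q p ∧
      ∃ ρ : ℕ → Q, ρ 0 = p ∧ (∀ i, A.Succ (ρ i) (ρ (i + 1))) ∧ ∀ i, ρ i ∉ A.accept := by
  rw [Set.ne_univ_iff_exists_notMem]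
  constructor
  · rintro ⟨w, hw⟩
    choose next hnext using hA
    let ρ : ℕ → Q := fun i => Nat.rec q (fun i p => next p (w.get i)) i
    have hρ : ∀ i, A.step (ρ i) (w.get i) = some (ρ (i + 1)) := fun i => hnext _ _
    have hF : ¬∃ᶠ i in Filter.atTop, ρ i ∈ A.accept := fun hF => hw ⟨ρ, ⟨rfl, hρ⟩, hF⟩
    rw [Filter.not_frequently, Filter.eventually_atTop] at hF
    obtain ⟨j, hj⟩ := hF
    have hreach : ∀ i, A.Reaches q (ρ i) := by
      intro i
      induction i with
      | zero => exact .refl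
      | succ i ih => exact ih.tail ⟨_, hρ i⟩
    exact ⟨ρ j, hreach j, fun i => ρ (j + i), rfl, fun i => ⟨_, hρ (j + i)⟩,
      fun i => hj _ (Nat.le_add_right j i)⟩
  · rintro ⟨p, hp, ρ, h0, hρ, hF⟩
    obtain ⟨x, hx⟩ := hp.exists_path
    choose w hw using hρ
    refine ⟨x ++ₛ w, fun h => ?_⟩
    obtain ⟨ρ', ⟨h0', hρ'⟩, hF'⟩ := (hx.append_mem_language_iff w).1 h
    -- By determinism the accepting run must be the path that avoids acceptance.
    have he : ∀ i, ρ' i = ρ i := by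
      intro i
      induction i with
      | zero => exact h0'.trans h0.symm
      | succ i ih =>
        have h1 : A.step (ρ' i) (w i) = some (ρ' (i + 1)) := hρ' i
        rw [ih, hw i] at h1
        exact (Option.some.inj h1).symm
    obtain ⟨i, hi⟩ := hF'.exists
    rw [he i] at hi
    exact hF i hi

/-! ### Completion by a sink -/

variable (A)

/-- The automaton completed by a rejecting sink `none`. -/
def completion : DBA (Option Q) S where
  start := some A.start
  step p a := some (p.bind fun q => A.step q a)
  accept := A.accept.map Embedding.some

theorem completion_isComplete : A.completion.IsComplete :=
  fun _ _ => ⟨_, rfl⟩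

/-- The sink is never left and does not accept, so an accepting run avoids it and is a run of the
original automaton. -/
theorem completion_language : A.completion.language = A.language := by
  ext w
  constructor
  · rintro ⟨ρ, ⟨h0, hρ⟩, hF⟩
    have hsink : ∀ i k, ρ i = none → ρ (i + k) = none := by
      intro i k hi
      induction k with
      | zero => exact hi
      | succ k ih =>
        have h1 : some ((ρ (i + k)).bind fun q => A.step q (w.get (i + k))) =
          some (ρ (i + k + 1)) := hρ (i + k)
        rw [ih] at h1
        exact (Option.some.inj h1).symm
    have hsome : ∀ i, ∃ q, ρ i = some q := by
      intro i
      rw [← Option.ne_none_iff_exists']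
      intro hi
      obtain ⟨j, hj, hF⟩ := Filter.frequently_atTop.1 hF i
      obtain ⟨k, rfl⟩ := Nat.exists_eq_add_of_le hj
      rw [hsink i k hi] at hF
      simp [completion] at hF
    choose σ hσ using hsome
    refine ⟨σ, ⟨?_, fun i => ?_⟩, hF.mono fun i hi => ?_⟩
    · rw [hσ 0] at h0
      exact Option.some.inj h0
    · have h1 : some ((ρ i).bind fun q => A.step q (w.get i)) = some (ρ (i + 1)) := hρ i
      rw [hσ, hσ] at h1
      exact Option.some.inj h1
    · rw [hσ] at hi
      simpa [completion] using hi
  · rintro ⟨ρ, ⟨h0, hρ⟩, hF⟩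
    refine ⟨fun i => some (ρ i), ⟨congrArg some h0, fun i => congrArg some (hρ i)⟩,
      hF.mono fun i hi => ?_⟩
    simpa [completion] using hi

end DBA

/-! ### Correctness of the decision procedure -/

namespace Instance

variable (I : Instance)

/-- A symbol is needed because the table always gives the sink a self-loop. -/
theorem mem_succs_iff (h : I.numSymbols ≠ 0) (v p : Option (Fin I.numStates)) :
    p ∈ I.succs v ↔ I.aut.completion.Succ v p := by
  have : NeZero I.numSymbols := ⟨h⟩
  cases v with
  | none => simp [succs, DBA.Succ, DBA.completion, eq_comm]
  | some q => simp [succs, DBA.Succ, DBA.completion]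

theorem acc_eq_true_iff (v : Option (Fin I.numStates)) :
    I.acc v = true ↔ v ∈ I.aut.completion.accept := by
  cases v <;> simp [acc, DBA.completion]

/-- The relation `R` is left open so that the characterisation also covers the empty alphabet, where
the table and the completed automaton differ. -/
theorem badStates_eq_true_iff
    {R : Option (Fin I.numStates) → Option (Fin I.numStates) → Prop}
    (hR : ∀ v p, p ∈ I.succs v ↔ R v p) (v : Option (Fin I.numStates)) : I.badStates v = true ↔
    ∃ q, ReflTransGen R v q ∧ ∀ p, ReflTransGen R q p →
      (∃ ρ : ℕ → _, ρ 0 = p ∧ (∀ i, R (ρ i) (ρ (i + 1))) ∧ ∀ i, ∃ j ≥ i, I.acc (ρ j) = true) ∧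
      ∃ p', ReflTransGen R p p' ∧
        ∃ ρ : ℕ → _, ρ 0 = p' ∧ (∀ i, R (ρ i) (ρ (i + 1))) ∧ ∀ i, I.acc (ρ i) = false := by
  have hN : Fintype.card (Option (Fin I.numStates)) ≤ I.numStates + 1 := by simp
  have hex : ∀ Y v, I.ex Y v = true ↔ ∃ p, R v p ∧ Y p = true := by
    intro Y v
    simp only [ex, List.any_eq_true, hR]
  have hc := closure_eq_true_iff hN hex
  have ha := iterate_eq_true_iff_exists_path_avoiding hN hex I.acc
  have hv := iterate_eq_true_iff_exists_path_visiting hN hex I.acc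
  refine (hc _ v).trans (exists_congr fun q => and_congr_right fun _ => ?_)
  rw [Bool.not_eq_true', ← Bool.not_eq_true, hc]
  refine not_exists.trans (forall_congr' fun p => not_and.trans (imp_congr_right fun _ => ?_))
  rw [Bool.not_eq_true', Bool.not_eq_false, Bool.and_eq_true]
  exact and_congr (hv p) ((hc _ p).trans (exists_congr fun p' => and_congr_right fun _ => ha p'))

theorem badStates_start_eq_false_iff :
    I.badStates (some I.aut.start) = false ↔ Monitorable I.aut.language := by
  rw [← Bool.not_eq_true]
  by_cases h : I.numSymbols = 0
  · have : IsEmpty (Fin I.numSymbols) := by rw [h]; infer_instance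
    -- Over the empty alphabet there are no infinite words, so every prefix is vacuously good. In
    -- the table all edges lead to the sink, so no infinite path visits acceptance infinitely often
    -- and no state is bad.
    refine iff_of_true ?_ fun x => ⟨[], Or.inl fun w => isEmptyElim (w.get 0)⟩
    rw [I.badStates_eq_true_iff (R := fun v p => p ∈ I.succs v) fun _ _ => Iff.rfl]
    rintro ⟨q, -, hq⟩
    obtain ⟨ρ, -, hρ, hF⟩ := (hq q .refl).1
    have hsucc : ∀ v p, p ∈ I.succs v → p = none := by
      rintro (- | v) p hp
      · simpa [succs] using hp
      · obtain ⟨a, -⟩ := List.mem_map.1 hp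
        exact isEmptyElim a
    obtain ⟨j, hj, hF⟩ := hF 1
    obtain ⟨j, rfl⟩ := Nat.exists_eq_add_of_le' hj
    rw [hsucc _ _ (hρ j)] at hF
    exact absurd hF (by simp [acc])
  · rw [← I.aut.completion_language, I.aut.completion_isComplete.monitorable_iff]
    have hbad : I.badStates (some I.aut.start) = true ↔
        ∃ q, I.aut.completion.Reaches (some I.aut.start) q ∧ ∀ p, I.aut.completion.Reaches q p →
          (I.aut.completion.startingAt p).language ≠ ∅ ∧
            (I.aut.completion.startingAt p).language ≠ Set.univ := by
      rw [I.badStates_eq_true_iff (I.mem_succs_iff h)]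
      simp only [← Bool.not_eq_true, I.acc_eq_true_iff, DBA.language_nonempty_iff,
        I.aut.completion_isComplete.language_ne_univ_iff]
      rfl
    rw [hbad]
    push Not
    refine forall₂_congr fun q _ => exists_congr fun p => and_congr_right fun _ => ?_
    rw [or_iff_not_imp_left, Set.nonempty_iff_ne_empty]

end Instance

end Monitorability

theorem mainTheorem5 :
    Monitorability.DecidableInPolyTime Monitorability.Instance.encode
        (fun I => Monitorability.Monitorable I.aut.language) ∧
      ∀ (Q S : Type) [Finite Q] [Finite S] (A : Monitorability.DBA Q S), A.IsComplete →
        (Monitorability.Monitorable A.language ↔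
          ∀ q : Q, A.Reaches A.start q →
            (∃ q' : Q, A.Reaches q q' ∧ (A.startingAt q').language = ∅) ∨
            (∃ q' : Q, A.Reaches q q' ∧ (A.startingAt q').language = Set.univ)) ∧
        ((∀ q : Q, A.Reaches A.start q → (A.startingAt q).language = ∅ → A.IsTrap q) →
          (Monitorability.Monitorable A.language ↔
            ∀ q : Q, A.Reaches A.start q →
              (∃ q' : Q, A.Reaches q q' ∧ A.IsTrap q') ∨
              (∃ q' : Q, A.Reaches q q' ∧ (A.startingAt q').language = Set.univ))) := by
  refine ⟨Monitorability.decidableInPolyTime_of_badStates _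
    Monitorability.Instance.badStates_start_eq_false_iff, fun Q S _ _ A hA => ?_⟩
  have h := hA.monitorable_iff
  simp only [and_or_left, exists_or] at h
  refine ⟨h, fun htrap => h.trans (forall₂_congr fun q hq => or_congr_left ?_)⟩
  -- A state reachable from a reachable `q` is itself reachable, so the hypothesis on empty states
  -- applies to it.
  exact exists_congr fun q' => and_congr_right fun hq' =>
    ⟨htrap q' (hq.trans hq'), Monitorability.DBA.IsTrap.language_eq_empty⟩
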